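/- Let $k$ be an algebraically closed field of characteristic $0$ and let $n\ge 0$ be an integer. Let $k[S_n]^c$ be the associative unital $k$-algebra with generators $s_1,\dots,s_{n-1}$ and relations $$s_i^2=-1,\qquad s_is_{i+1}s_i=s_{i+1}s_is_{i+1},\qquad s_is_j=-s_js_i\quad(|i-j|\ge 2),$$ regarded as a superalgebra ($\mathbb Z/2$-graded algebra) with all $s_i$ odd. Consider right $k[S_n]^c$-supermodules $M=M_{\bar 0}\oplus M_{\bar 1}$ and grading-preserving (even) morphisms. For a supermodule $M$ let $\Pi M$ denote $M$ with the grading shifted: $(\Pi M)_{\bar 0}=M_{\bar 1}$, $(\Pi M)_{\bar 1}=M_{\bar 0}$. A supermodule is irreducible if it is nonzero and its only graded submodules are $0$ and itself. An irreducible supermodule $M$ is called self-associate if $M\cong\Pi M$, and absolutely irreducible otherwise. Consider the isomorphism classes of irreducible supermodules up to shift of grading, i.e. identify $M$ and $N$ whenever $M\cong N$ or $M\cong\Pi N$. A strict partition of $n$ is a partition of $n$ with pairwise distinct parts; a partition of $n$ is called even (resp. odd) if the permutations in $S_n$ with that cycle type are even (resp. odd). Then there are only finitely many isomorphism classes of irreducible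 right $k[S_n]^c$-supermodules up to shift of grading, and their number equals the number of strict partitions of $n$. Among these classes, the number of absolutely irreducible ones equals the number of even strict partitions of $n$, and the number of self-associate ones equals the number of odd strict partitions of $n$. -/

import Mathlib

open scoped DirectSum

universe u

/-! ### The twisted group superalgebra of the symmetric group -/

namespace TwistedSymmetricGroup

/-- The defining relations of the twisted group algebra: `s i ^ 2 = -1`,
`s i * s (i + 1) * s i = s (i + 1) * s i * s (i + 1)`, and
`s i * s j = - (s j * s i)` for `|i - j| ≥ 2`.  The generators `s_1, …, s_{n-1}` are indexed
by `Fin (n - 1)` (so there are none for `n = 0` and for `n = 1`). -/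
inductive Rel (k : Type*) [Field k] (n : ℕ) :
    FreeAlgebra k (Fin (n - 1)) → FreeAlgebra k (Fin (n - 1)) → Prop
  | sq (i : Fin (n - 1)) :
      Rel k n (FreeAlgebra.ι k i * FreeAlgebra.ι k i) (-1)
  | braid (i j : Fin (n - 1)) (h : (i : ℕ) + 1 = j) :
      Rel k n (FreeAlgebra.ι k i * FreeAlgebra.ι k j * FreeAlgebra.ι k i)
        (FreeAlgebra.ι k j * FreeAlgebra.ι k i * FreeAlgebra.ι k j)
  | anticomm (i j : Fin (n - 1)) (h : (i : ℕ) + 2 ≤ j ∨ (j : ℕ) + 2 ≤ i) :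
      Rel k n (FreeAlgebra.ι k i * FreeAlgebra.ι k j)
        (-(FreeAlgebra.ι k j * FreeAlgebra.ι k i))

/-- The twisted group algebra `k[S_n]^c`. -/
abbrev Alg (k : Type*) [Field k] (n : ℕ) : Type _ := RingQuot (Rel k n)

/-- The generator `s_i` of `k[S_n]^c`. -/
def s (k : Type*) [Field k] (n : ℕ) (i : Fin (n - 1)) : Alg k n :=
  RingQuot.mkAlgHom k (Rel k n) (FreeAlgebra.ι k i)

/-- The homogeneous component of degree `d` of `k[S_n]^c` for the `ℤ/2`-grading in which all
`s_i` are odd: it is spanned by the products of generators whose number of factors is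
congruent to `d` modulo `2`. -/
def grading (k : Type*) [Field k] (n : ℕ) (d : ZMod 2) : Submodule k (Alg k n) :=
  Submodule.span k {a | ∃ l : List (Fin (n - 1)), (l.length : ZMod 2) = d ∧ a = (l.map (s k n)).prod}

section
variable (k : Type*) [Field k] (n : ℕ)

theorem s_sq (i : Fin (n - 1)) : s k n i * s k n i = -1 := by
  have h := RingQuot.mkAlgHom_rel k (Rel.sq (k := k) i)
  simpa [s] using h

theorem s_braid (i j : Fin (n - 1)) (h : (i : ℕ) + 1 = j) :
    s k n i * s k n j * s k n i = s k n j * s k n i * s k n j := by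
  have h := RingQuot.mkAlgHom_rel k (Rel.braid (k := k) i j h)
  simpa [s] using h

theorem s_anticomm (i j : Fin (n - 1)) (h : (i : ℕ) + 2 ≤ j ∨ (j : ℕ) + 2 ≤ i) :
    s k n i * s k n j = -(s k n j * s k n i) := by
  have h := RingQuot.mkAlgHom_rel k (Rel.anticomm (k := k) i j h)
  simpa [s] using h

theorem prod_mem_grading (l : List (Fin (n - 1))) :
    (l.map (s k n)).prod ∈ grading k n (l.length : ZMod 2) :=
  Submodule.subset_span ⟨l, rfl, rfl⟩

theorem s_mem_grading (i : Fin (n - 1)) : s k n i ∈ grading k n 1 := by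
  simpa using prod_mem_grading k n [i]

instance gradedMonoid_grading : SetLike.GradedMonoid (grading k n) where
  one_mem := by simpa using prod_mem_grading k n []
  mul_mem := by
    intro d e a b ha hb
    have h : a * b ∈ grading k n d * grading k n e := Submodule.mul_mem_mul ha hb
    rw [grading, grading, Submodule.span_mul_span] at h
    refine Submodule.span_mono ?_ h
    rintro _ ⟨_, ⟨l, rfl, rfl⟩, _, ⟨m, rfl, rfl⟩, rfl⟩
    exact ⟨l ++ m, by simp, by simp⟩

/-- The generator `s_i`, placed in degree `1`. -/
def gradedS (i : Fin (n - 1)) : ⨁ d : ZMod 2, grading k n d :=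
  DirectSum.of (fun d => ↥(grading k n d)) 1 ⟨s k n i, s_mem_grading k n i⟩

/-- The decomposition into homogeneous components, as an algebra homomorphism. -/
def decomposeHom : Alg k n →ₐ[k] ⨁ d : ZMod 2, grading k n d :=
  RingQuot.liftAlgHom k ⟨FreeAlgebra.lift k (gradedS k n), by
    intro x y h
    have hneg : ∀ z, FreeAlgebra.lift k (gradedS k n) (-z) =
        (-1 : k) • FreeAlgebra.lift k (gradedS k n) z := fun z => by
      rw [← map_smul, neg_one_smul]
    have hof : ∀ (d : ZMod 2) (z : grading k n d),
        (-1 : k) • DirectSum.of (fun d => ↥(grading k n d)) d z =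
          DirectSum.of (fun d => ↥(grading k n d)) d ((-1 : k) • z) := fun d z =>
      (map_smul (DirectSum.lof k (ZMod 2) (fun d => ↥(grading k n d)) d) (-1 : k) z).symm
    cases h with
    | sq i =>
      simp only [map_mul, map_one, hneg, FreeAlgebra.lift_ι_apply, gradedS,
        DirectSum.of_mul_of]
      rw [DirectSum.one_def, hof]
      exact DirectSum.of_eq_of_gradedMonoid_eq (Sigma.subtype_ext rfl
        ((s_sq k n i).trans (neg_one_smul k (1 : Alg k n)).symm))
    | braid i j hij =>
      simp only [map_mul, FreeAlgebra.lift_ι_apply, gradedS, DirectSum.of_mul_of]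
      exact DirectSum.of_eq_of_gradedMonoid_eq (Sigma.subtype_ext rfl (s_braid k n i j hij))
    | anticomm i j hij =>
      simp only [map_mul, hneg, FreeAlgebra.lift_ι_apply, gradedS, DirectSum.of_mul_of]
      rw [hof]
      exact DirectSum.of_eq_of_gradedMonoid_eq (Sigma.subtype_ext rfl
        ((s_anticomm k n i j hij).trans (neg_one_smul k (s k n j * s k n i)).symm))⟩

theorem decomposeHom_s (i : Fin (n - 1)) : decomposeHom k n (s k n i) = gradedS k n i := by
  rw [decomposeHom, s, RingQuot.liftAlgHom_mkAlgHom_apply, FreeAlgebra.lift_ι_apply]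

theorem decomposeHom_prod (l : List (Fin (n - 1))) :
    decomposeHom k n (l.map (s k n)).prod =
      DirectSum.of (fun d => ↥(grading k n d)) (l.length : ZMod 2)
        ⟨(l.map (s k n)).prod, prod_mem_grading k n l⟩ := by
  induction l with
  | nil =>
    simp only [List.map_nil, List.prod_nil, map_one]
    rw [DirectSum.one_def]
    exact DirectSum.of_eq_of_gradedMonoid_eq (Sigma.subtype_ext Nat.cast_zero.symm rfl)
  | cons i l ih =>
    simp only [List.map_cons, List.prod_cons, map_mul]
    rw [ih, decomposeHom_s, gradedS, DirectSum.of_mul_of]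
    refine DirectSum.of_eq_of_gradedMonoid_eq (Sigma.subtype_ext ?_ rfl)
    exact (add_comm _ _).trans (Nat.cast_succ _).symm

/-- `k[S_n]^c` is a superalgebra. -/
instance gradedAlgebra_grading : GradedAlgebra (grading k n) :=
  GradedAlgebra.ofAlgHom (grading k n) (decomposeHom k n)
    (by
      apply RingQuot.ringQuot_ext'
      ext i
      change DirectSum.coeAlgHom (grading k n) (decomposeHom k n (s k n i)) = s k n i
      rw [decomposeHom_s, gradedS, DirectSum.coeAlgHom_of])
    (by
      rintro d ⟨x, hx⟩
      change decomposeHom k n x = _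
      refine Submodule.span_induction
        (p := fun x hx => decomposeHom k n x =
          DirectSum.of (fun d => ↥(grading k n d)) d ⟨x, hx⟩) ?_ ?_ ?_ ?_ hx
      · rintro x ⟨l, rfl, rfl⟩
        exact decomposeHom_prod k n l
      · exact (map_zero _).trans (map_zero (DirectSum.of (fun d => ↥(grading k n d)) d)).symm
      · intro x y hx hy ihx ihy
        rw [map_add, ihx, ihy, ← map_add]
        rfl
      · intro c x hx ih
        rw [map_smul, ih]
        exact (map_smul (DirectSum.lof k (ZMod 2) (fun d => ↥(grading k n d)) d) c ⟨x, hx⟩).symm)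

end

end TwistedSymmetricGroup

/-! ### Right supermodules over a superalgebra -/

/-- A right supermodule over the `k`-superalgebra `A = 𝒜 0 ⊕ 𝒜 1`: a right `A`-module `M`
with a decomposition `M = M_0 ⊕ M_1` into `k`-subspaces such that `M_i · 𝒜 j ⊆ M_{i+j}`. -/
structure RightSupermodule {k A : Type u} [Field k] [Ring A] [Algebra k A]
    (𝒜 : ZMod 2 → Submodule k A) [GradedAlgebra 𝒜] where
  carrier : Type u
  [addCommGroup : AddCommGroup carrier]
  [moduleField : Module k carrier]
  [module : Module Aᵐᵒᵖ carrier]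
  [isScalarTower : IsScalarTower k Aᵐᵒᵖ carrier]
  gr : ZMod 2 → Submodule k carrier
  isCompl : IsCompl (gr 0) (gr 1)
  smul_mem : ∀ (i j : ZMod 2) (m : carrier) (a : A),
    m ∈ gr i → a ∈ 𝒜 j → MulOpposite.op a • m ∈ gr (i + j)

namespace RightSupermodule

attribute [instance] addCommGroup moduleField module isScalarTower

variable {k A : Type u} [Field k] [Ring A] [Algebra k A]
  {𝒜 : ZMod 2 → Submodule k A} [GradedAlgebra 𝒜]

/-- The parity shift `Π M`: `(Π M)_0 = M_1`, `(Π M)_1 = M_0`, with the same right action. -/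
def parityShift (M : RightSupermodule 𝒜) : RightSupermodule 𝒜 where
  carrier := M.carrier
  gr i := M.gr (i + 1)
  isCompl := M.isCompl.symm
  smul_mem i j m a hm ha := by
    have h := M.smul_mem (i + 1) j m a hm ha
    rwa [add_right_comm] at h

/-- Isomorphisms of supermodules are the even (that is, grading-preserving) ones. -/
structure Iso (M N : RightSupermodule 𝒜) where
  toLinearEquiv : M.carrier ≃ₗ[Aᵐᵒᵖ] N.carrier
  mem_iff : ∀ (i : ZMod 2) (m : M.carrier), toLinearEquiv m ∈ N.gr i ↔ m ∈ M.gr i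

/-- The identity isomorphism. -/
def Iso.refl (M : RightSupermodule 𝒜) : Iso M M := ⟨LinearEquiv.refl _ _, fun _ _ => Iff.rfl⟩

/-- The inverse isomorphism. -/
def Iso.symm {M N : RightSupermodule 𝒜} (e : Iso M N) : Iso N M :=
  ⟨e.toLinearEquiv.symm, fun i m => by
    rw [← e.mem_iff, LinearEquiv.apply_symm_apply]⟩

/-- The composite of two isomorphisms. -/
def Iso.trans {M N P : RightSupermodule 𝒜} (e : Iso M N) (f : Iso N P) : Iso M P :=
  ⟨e.toLinearEquiv.trans f.toLinearEquiv, fun i m => (f.mem_iff i _).trans (e.mem_iff i m)⟩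

/-- The parity shift of an isomorphism. -/
def Iso.shift {M N : RightSupermodule 𝒜} (e : Iso M N) : Iso M.parityShift N.parityShift :=
  ⟨e.toLinearEquiv, fun i m => e.mem_iff (i + 1) m⟩

/-- `Π (Π M)` is `M`. -/
def Iso.shiftShift (M : RightSupermodule 𝒜) : Iso M.parityShift.parityShift M :=
  ⟨LinearEquiv.refl Aᵐᵒᵖ M.carrier, fun i m => by
    change m ∈ M.gr i ↔ m ∈ M.gr (i + 1 + 1)
    rw [add_assoc, show (1 : ZMod 2) + 1 = 0 from rfl, add_zero]⟩

/-- An `A`-submodule is graded if it contains the homogeneous components of its elements. -/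
def IsGradedSubmodule (M : RightSupermodule 𝒜) (N : Submodule Aᵐᵒᵖ M.carrier) : Prop :=
  ∀ m₀ ∈ M.gr 0, ∀ m₁ ∈ M.gr 1, m₀ + m₁ ∈ N → m₀ ∈ N ∧ m₁ ∈ N

/-- A supermodule is irreducible if it is nonzero and has no graded submodules other than zero
and itself. -/
def IsIrreducible (M : RightSupermodule 𝒜) : Prop :=
  Nontrivial M.carrier ∧
    ∀ N : Submodule Aᵐᵒᵖ M.carrier, M.IsGradedSubmodule N → N = ⊥ ∨ N = ⊤

/-- `M` is self-associate if it is isomorphic to `Π M`. -/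
def IsSelfAssociate (M : RightSupermodule 𝒜) : Prop := Nonempty (Iso M M.parityShift)

/-- `M` and `N` are isomorphic up to shift of grading: `M ≅ N` or `M ≅ Π N`. -/
def IsoUpToShift (M N : RightSupermodule 𝒜) : Prop :=
  Nonempty (Iso M N) ∨ Nonempty (Iso M N.parityShift)

theorem isSelfAssociate_of_isoUpToShift {M N : RightSupermodule 𝒜} (h : IsoUpToShift M N)
    (hM : M.IsSelfAssociate) : N.IsSelfAssociate := by
  obtain ⟨f⟩ := hM
  rcases h with ⟨⟨e⟩⟩ | ⟨⟨e⟩⟩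
  · exact ⟨e.symm.trans (f.trans e.shift)⟩
  · exact ⟨((Iso.shiftShift N).symm.trans e.shift.symm).trans (f.symm.trans e)⟩

variable (𝒜) in
/-- Isomorphism up to shift of grading, on irreducible supermodules. -/
instance irreducibleSetoid : Setoid {M : RightSupermodule 𝒜 // M.IsIrreducible} where
  r M N := IsoUpToShift M.1 N.1
  iseqv :=
    { refl := fun M => Or.inl ⟨Iso.refl M.1⟩
      symm := by
        rintro M N (⟨⟨e⟩⟩ | ⟨⟨e⟩⟩)
        · exact Or.inl ⟨e.symm⟩
        · exact Or.inr ⟨((e.shift).trans (Iso.shiftShift N.1)).symm⟩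
      trans := by
        rintro M N P (⟨⟨e⟩⟩ | ⟨⟨e⟩⟩) (⟨⟨f⟩⟩ | ⟨⟨f⟩⟩)
        · exact Or.inl ⟨e.trans f⟩
        · exact Or.inr ⟨e.trans f⟩
        · exact Or.inr ⟨e.trans f.shift⟩
        · exact Or.inl ⟨(e.trans f.shift).trans (Iso.shiftShift P.1)⟩ }

end RightSupermodule

/-- The isomorphism classes, up to shift of grading, of irreducible right supermodules. -/
def IrreducibleClass {k A : Type u} [Field k] [Ring A] [Algebra k A]
    (𝒜 : ZMod 2 → Submodule k A) [GradedAlgebra 𝒜] : Type (u + 1) :=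
  Quotient (RightSupermodule.irreducibleSetoid 𝒜)

namespace IrreducibleClass

variable {k A : Type u} [Field k] [Ring A] [Algebra k A]
  {𝒜 : ZMod 2 → Submodule k A} [GradedAlgebra 𝒜]

/-- The class consists of self-associate supermodules. -/
def IsSelfAssociate (c : IrreducibleClass 𝒜) : Prop :=
  Quotient.lift (s := RightSupermodule.irreducibleSetoid 𝒜) (fun M => M.1.IsSelfAssociate)
    (fun _ _ h => propext ⟨RightSupermodule.isSelfAssociate_of_isoUpToShift h,
      RightSupermodule.isSelfAssociate_of_isoUpToShift
        ((RightSupermodule.irreducibleSetoid 𝒜).symm h)⟩) c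

/-- The class consists of absolutely irreducible supermodules: the irreducible ones that are not
self-associate. -/
def IsAbsolutelyIrreducible (c : IrreducibleClass 𝒜) : Prop := ¬ c.IsSelfAssociate

end IrreducibleClass

/-! ### Strict partitions -/

namespace Nat.Partition

/-- A partition is strict if its parts are pairwise distinct. -/
def IsStrict {n : ℕ} (p : n.Partition) : Prop := p.parts.Nodup

/-- A partition of `n` is even if the corresponding conjugacy class of `S_n` consists of even
permutations.  (The cycle type used here includes the fixed points as parts equal to `1`.) -/
def IsEven {n : ℕ} (p : n.Partition) : Prop :=
  ∃ σ : Equiv.Perm (Fin n), σ.partition.parts = p.parts ∧ Equiv.Perm.sign σ = 1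

/-- A partition of `n` is odd if the corresponding conjugacy class of `S_n` consists of odd
permutations. -/
def IsOdd {n : ℕ} (p : n.Partition) : Prop :=
  ∃ σ : Equiv.Perm (Fin n), σ.partition.parts = p.parts ∧ Equiv.Perm.sign σ = -1

end Nat.Partition

/-! Two dimensions of the centre count the classes. Over a finite-dimensional semisimple
superalgebra, Schur's lemma says that the even endomorphisms of an irreducible supermodule are the
scalars, and that nonzero odd ones, unique up to a scalar, exist exactly in the self-associate case.
By density, and because the irreducibles are jointly faithful, the even centre has one dimension for
each class (`IrreducibleClass.card_eq_finrank_gradedCenter_zero`) and the odd centre one for each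
self-associate class (`IrreducibleClass.card_isSelfAssociate_eq_finrank_gradedCenter_one`).

The twisted group algebra has a basis of lifts of permutations, unique up to sign. A coset argument
bounds its dimension above by $n!$ (`exists_finset_adjoin_le_span`); sending $s_i$ to the
transposition $(i, i+1)$ with the simple root in a Clifford algebra as coefficient shows that the
lifts are independent (`TwistedSymmetricGroup.linearIndependent_lift`). A trace argument then gives
semisimplicity.

Central elements are combinations of signed class sums. The class of $g$ contributes exactly when
$g$ is split, that is, when its lift commutes with the lifts of its whole centralizer
(`LiftSystem.finrank_central_eq_card`). Lifts of disjoint permutations anticommute if both are odd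
and commute otherwise. Hence an even permutation is split iff all its cycles have odd length, and an
odd one iff its parts, fixed points included, are distinct. Euler's theorem turns partitions into
odd parts into strict partitions, and the absolutely irreducible count follows by subtraction. -/

/-! ### The parity involutions of a superalgebra and of its supermodules -/

section Superalgebra

variable {k A : Type u} [Field k] [Ring A] [Algebra k A]

/-- The parity involution `a₀ + a₁ ↦ a₀ - a₁` of a superalgebra. -/
noncomputable def parityConj (𝒜 : ZMod 2 → Submodule k A) [GradedAlgebra 𝒜] : A →ₗ[k] A :=
  GradedAlgebra.proj 𝒜 0 - GradedAlgebra.proj 𝒜 1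

variable (𝒜 : ZMod 2 → Submodule k A) [GradedAlgebra 𝒜]

theorem exists_eq_add_of_grading (a : A) : ∃ a₀ ∈ 𝒜 0, ∃ a₁ ∈ 𝒜 1, a = a₀ + a₁ := by
  classical
  refine ⟨_, (DirectSum.decompose 𝒜 a 0).2, _, (DirectSum.decompose 𝒜 a 1).2, ?_⟩
  conv_lhs => rw [← DirectSum.sum_support_decompose 𝒜 a]
  rw [Finset.sum_subset (Finset.subset_univ _)]
  · exact Fin.sum_univ_two _
  · intro i _ hi
    simpa using hi

variable {𝒜}

theorem parityConj_of_mem_zero {a : A} (ha : a ∈ 𝒜 0) : parityConj 𝒜 a = a := by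
  simp only [parityConj, LinearMap.sub_apply, GradedAlgebra.proj_apply]
  rw [DirectSum.decompose_of_mem_same 𝒜 ha, DirectSum.decompose_of_mem_ne 𝒜 ha (by decide),
    sub_zero]

theorem parityConj_of_mem_one {a : A} (ha : a ∈ 𝒜 1) : parityConj 𝒜 a = -a := by
  simp only [parityConj, LinearMap.sub_apply, GradedAlgebra.proj_apply]
  rw [DirectSum.decompose_of_mem_same 𝒜 ha, DirectSum.decompose_of_mem_ne 𝒜 ha (by decide),
    zero_sub]

theorem eq_zero_of_two_smul_eq_zero {V : Type*} [AddCommGroup V] [Module k V] [CharZero k]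
    {v : V} (h : v + v = 0) : v = 0 := by
  rw [← two_smul k] at h
  exact (smul_eq_zero.1 h).resolve_left two_ne_zero

variable [CharZero k]

theorem mem_zero_iff_parityConj {a : A} : a ∈ 𝒜 0 ↔ parityConj 𝒜 a = a := by
  refine ⟨parityConj_of_mem_zero, fun h => ?_⟩
  obtain ⟨a₀, h₀, a₁, h₁, rfl⟩ := exists_eq_add_of_grading 𝒜 a
  rw [map_add, parityConj_of_mem_zero h₀, parityConj_of_mem_one h₁, add_right_inj] at h
  rwa [eq_zero_of_two_smul_eq_zero (k := k) (add_eq_zero_iff_eq_neg.2 h.symm), add_zero]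

theorem mem_one_iff_parityConj {a : A} : a ∈ 𝒜 1 ↔ parityConj 𝒜 a = -a := by
  refine ⟨parityConj_of_mem_one, fun h => ?_⟩
  obtain ⟨a₀, h₀, a₁, h₁, rfl⟩ := exists_eq_add_of_grading 𝒜 a
  rw [map_add, parityConj_of_mem_zero h₀, parityConj_of_mem_one h₁, neg_add, add_left_inj] at h
  rwa [eq_zero_of_two_smul_eq_zero (k := k) (add_eq_zero_iff_eq_neg.2 h), zero_add]

end Superalgebra

namespace RightSupermodule

open MulOpposite

variable {k A : Type u} [Field k] [Ring A] [Algebra k A]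
  {𝒜 : ZMod 2 → Submodule k A} [GradedAlgebra 𝒜]

/-- The parity involution `m₀ + m₁ ↦ m₀ - m₁` of a supermodule. -/
noncomputable def parity (M : RightSupermodule 𝒜) : M.carrier →ₗ[k] M.carrier :=
  (M.gr 0).projection (M.gr 1) M.isCompl - (M.gr 1).projection (M.gr 0) M.isCompl.symm

variable (M N : RightSupermodule 𝒜)

theorem exists_eq_add (m : M.carrier) : ∃ m₀ ∈ M.gr 0, ∃ m₁ ∈ M.gr 1, m = m₀ + m₁ :=
  ⟨_, Submodule.projection_apply_mem M.isCompl m, _,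
    Submodule.projection_apply_mem M.isCompl.symm m,
    (Submodule.projection_add_projection_eq_self M.isCompl m).symm⟩

variable {M N}

theorem parity_of_mem_zero {m : M.carrier} (hm : m ∈ M.gr 0) : M.parity m = m := by
  rw [parity, LinearMap.sub_apply, Submodule.projection_apply_of_mem_left _ hm,
    Submodule.projection_apply_of_mem_right _ hm, sub_zero]

theorem parity_of_mem_one {m : M.carrier} (hm : m ∈ M.gr 1) : M.parity m = -m := by
  rw [parity, LinearMap.sub_apply, Submodule.projection_apply_of_mem_right _ hm,
    Submodule.projection_apply_of_mem_left _ hm, zero_sub]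

@[simp] theorem parity_parity (m : M.carrier) : M.parity (M.parity m) = m := by
  obtain ⟨m₀, h₀, m₁, h₁, rfl⟩ := M.exists_eq_add m
  simp [parity_of_mem_zero h₀, parity_of_mem_one h₁]

theorem parity_smul (a : A) (m : M.carrier) :
    M.parity (op a • m) = op (parityConj 𝒜 a) • M.parity m := by
  obtain ⟨m₀, h₀, m₁, h₁, rfl⟩ := M.exists_eq_add m
  obtain ⟨a₀, g₀, a₁, g₁, rfl⟩ := exists_eq_add_of_grading 𝒜 a
  have h00 := parity_of_mem_zero (M.smul_mem 0 0 m₀ a₀ h₀ g₀)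
  have h01 := parity_of_mem_one (M.smul_mem 0 1 m₀ a₁ h₀ g₁)
  have h10 := parity_of_mem_one (M.smul_mem 1 0 m₁ a₀ h₁ g₀)
  have h11 := parity_of_mem_zero (M.smul_mem 1 1 m₁ a₁ h₁ g₁)
  simp only [smul_add, map_add, op_add, add_smul, h00, h01, h10, h11, parity_of_mem_zero h₀,
    parity_of_mem_one h₁, parityConj_of_mem_zero g₀, parityConj_of_mem_one g₁, op_neg, neg_smul,
    smul_neg]
  abel

theorem parityShift_parity (m : M.carrier) : M.parityShift.parity m = - M.parity m := by
  obtain ⟨m₀, h₀, m₁, h₁, rfl⟩ := M.exists_eq_add m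
  have e₁ := parity_of_mem_zero (M := M.parityShift) (m := m₁) h₁
  have e₀ := parity_of_mem_one (M := M.parityShift) (m := m₀) h₀
  refine (map_add M.parityShift.parity m₀ m₁).trans ((congrArg₂ (· + ·) e₀ e₁).trans ?_)
  rw [map_add, parity_of_mem_zero h₀, parity_of_mem_one h₁, neg_add, neg_neg]
  rfl

theorem Iso.map_parity (e : Iso M N) (m : M.carrier) :
    e.toLinearEquiv (M.parity m) = N.parity (e.toLinearEquiv m) := by
  obtain ⟨m₀, h₀, m₁, h₁, rfl⟩ := M.exists_eq_add m
  simp only [map_add, map_neg, parity_of_mem_zero h₀, parity_of_mem_one h₁,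
    parity_of_mem_zero ((e.mem_iff 0 _).2 h₀), parity_of_mem_one ((e.mem_iff 1 _).2 h₁)]

/-! ### Parity eigenspaces and Schur's lemma for homogeneous maps. -/

section CharZero
variable [CharZero k]

theorem mem_zero_iff {m : M.carrier} : m ∈ M.gr 0 ↔ M.parity m = m := by
  refine ⟨parity_of_mem_zero, fun h => ?_⟩
  obtain ⟨m₀, h₀, m₁, h₁, rfl⟩ := M.exists_eq_add m
  rw [map_add, parity_of_mem_zero h₀, parity_of_mem_one h₁, add_right_inj] at h
  rwa [eq_zero_of_two_smul_eq_zero (k := k) (add_eq_zero_iff_eq_neg.2 h.symm), add_zero]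

theorem mem_one_iff {m : M.carrier} : m ∈ M.gr 1 ↔ M.parity m = -m := by
  refine ⟨parity_of_mem_one, fun h => ?_⟩
  obtain ⟨m₀, h₀, m₁, h₁, rfl⟩ := M.exists_eq_add m
  rw [map_add, parity_of_mem_zero h₀, parity_of_mem_one h₁, neg_add, add_left_inj] at h
  rwa [eq_zero_of_two_smul_eq_zero (k := k) (add_eq_zero_iff_eq_neg.2 h), zero_add]

/-- Since 2 is invertible, the components of $m$ are half the sum and half the difference of $m$ and
its parity image. -/
theorem isGradedSubmodule_iff {L : Submodule Aᵐᵒᵖ M.carrier} :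
    M.IsGradedSubmodule L ↔ ∀ m ∈ L, M.parity m ∈ L := by
  constructor
  · intro h m hm
    obtain ⟨m₀, h₀, m₁, h₁, rfl⟩ := M.exists_eq_add m
    obtain ⟨g₀, g₁⟩ := h m₀ h₀ m₁ h₁ hm
    rw [map_add, parity_of_mem_zero h₀, parity_of_mem_one h₁]
    exact L.add_mem g₀ (L.neg_mem g₁)
  · intro h m₀ h₀ m₁ h₁ hm
    have hp := h _ hm
    rw [map_add, parity_of_mem_zero h₀, parity_of_mem_one h₁] at hp
    have key : ∀ m, m + m ∈ L → m ∈ L := fun m hm => by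
      have := L.smul_of_tower_mem (2⁻¹ : k) hm
      rwa [← two_smul k, smul_smul, inv_mul_cancel₀ two_ne_zero, one_smul] at this
    constructor
    · refine key _ ?_
      convert L.add_mem hm hp using 1
      abel
    · refine key _ ?_
      convert L.sub_mem hm hp using 1
      abel

theorem mem_gr_of_comm {M N : RightSupermodule 𝒜} {f : M.carrier → N.carrier}
    (h : ∀ m, f (M.parity m) = N.parity (f m)) (hf : ∀ m, f (-m) = - f m) (i : ZMod 2)
    {m : M.carrier} (hm : m ∈ M.gr i) : f m ∈ N.gr i := by
  fin_cases i
  · exact mem_zero_iff.2 (by rw [← h, parity_of_mem_zero hm])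
  · exact mem_one_iff.2 (by rw [← h, parity_of_mem_one hm, hf])

/-- A bijective module homomorphism which commutes with the parity is an isomorphism of
supermodules. -/
noncomputable def isoOfBijective (f : M.carrier →ₗ[Aᵐᵒᵖ] N.carrier) (hf : Function.Bijective f)
    (h : ∀ m, f (M.parity m) = N.parity (f m)) : Iso M N where
  toLinearEquiv := LinearEquiv.ofBijective f hf
  mem_iff i m := by
    set e := LinearEquiv.ofBijective f hf
    have he : ∀ n, e.symm (N.parity n) = M.parity (e.symm n) := fun n =>
      hf.1 (by
        rw [h]
        change e _ = N.parity (e _)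
        simp)
    refine ⟨fun hm => ?_, fun hm => mem_gr_of_comm h (map_neg f) i hm⟩
    simpa using mem_gr_of_comm he (map_neg e.symm) i hm

/-- A bijective module homomorphism which anticommutes with the parity is an isomorphism onto
the parity shift. -/
noncomputable def isoShiftOfBijective (f : M.carrier →ₗ[Aᵐᵒᵖ] N.carrier)
    (hf : Function.Bijective f) (h : ∀ m, f (M.parity m) = -N.parity (f m)) :
    Iso M N.parityShift :=
  isoOfBijective (N := N.parityShift) f hf fun m => (h m).trans (parityShift_parity _).symm

/-- Schur's lemma for homogeneous homomorphisms. -/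
theorem eq_zero_or_bijective (hM : M.IsIrreducible) (hN : N.IsIrreducible)
    (f : M.carrier →ₗ[Aᵐᵒᵖ] N.carrier) (c : ℤˣ)
    (h : ∀ m, f (M.parity m) = c • N.parity (f m)) : f = 0 ∨ Function.Bijective f := by
  have hc : ∀ m, c • f (M.parity m) = N.parity (f m) := fun m => by
    rw [h, smul_smul, Int.units_mul_self, one_smul]
  -- The sign `c` treats even and odd maps at once: in both cases kernel and range are stable under
  -- parity.
  have hker : M.IsGradedSubmodule (LinearMap.ker f) := isGradedSubmodule_iff.2 fun m hm => by
    rw [LinearMap.mem_ker] at hm ⊢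
    rw [h, hm, map_zero, smul_zero]
  have hrange : N.IsGradedSubmodule (LinearMap.range f) := isGradedSubmodule_iff.2 <| by
    rintro _ ⟨m, rfl⟩
    rw [← hc]
    rcases Int.units_eq_one_or c with rfl | rfl
    · exact ⟨_, (one_smul _ _).symm⟩
    · exact ⟨-M.parity m, by simp⟩
  rcases hM.2 _ hker with h1 | h1
  · rcases hN.2 _ hrange with h2 | h2
    · exact Or.inl (LinearMap.range_eq_bot.1 h2)
    · exact Or.inr ⟨LinearMap.ker_eq_bot.1 h1, LinearMap.range_eq_top.1 h2⟩
  · exact Or.inl (LinearMap.ker_eq_top.1 h1)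

end CharZero

theorem parityConj_parityConj (a : A) : parityConj 𝒜 (parityConj 𝒜 a) = a := by
  obtain ⟨a₀, g₀, a₁, g₁, rfl⟩ := exists_eq_add_of_grading 𝒜 a
  simp [parityConj_of_mem_zero g₀, parityConj_of_mem_one g₁]

/-- The conjugate of a module homomorphism by the parity involutions. -/
noncomputable def twist (f : M.carrier →ₗ[Aᵐᵒᵖ] N.carrier) : M.carrier →ₗ[Aᵐᵒᵖ] N.carrier where
  toFun m := N.parity (f (M.parity m))
  map_add' := by simp
  map_smul' a m := by
    induction a using MulOpposite.rec' with
    | h a => rw [parity_smul, map_smul, parity_smul, parityConj_parityConj]; rfl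

theorem twist_apply (f : M.carrier →ₗ[Aᵐᵒᵖ] N.carrier) (m : M.carrier) :
    twist f m = N.parity (f (M.parity m)) := rfl

variable [CharZero k]

/-- There are no nonzero homomorphisms between irreducible supermodules which are not isomorphic
up to shift of grading. -/
theorem eq_zero_of_not_isoUpToShift (hM : M.IsIrreducible) (hN : N.IsIrreducible)
    (h : ¬ IsoUpToShift M N) (f : M.carrier →ₗ[Aᵐᵒᵖ] N.carrier) : f = 0 := by
  -- Twice the even part and twice the odd part of `f` vanish separately by Schur's lemma; a
  -- bijective one would be an isomorphism onto the target or onto its shift.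
  have h₀ : f + twist f = 0 := by
    have hp : ∀ m, (f + twist f) (M.parity m) = N.parity ((f + twist f) m) := fun m => by
      simp [twist_apply, add_comm]
    refine (eq_zero_or_bijective hM hN _ 1 fun m => by rw [hp, one_smul]).resolve_right
      fun hb => h (Or.inl ⟨isoOfBijective _ hb hp⟩)
  have h₁ : f - twist f = 0 := by
    have hp : ∀ m, (f - twist f) (M.parity m) = -N.parity ((f - twist f) m) := fun m => by
      simp [twist_apply]
    refine (eq_zero_or_bijective hM hN _ (-1) fun m => by
      rw [hp, Units.neg_smul, one_smul]).resolve_right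
      fun hb => h (Or.inr ⟨isoShiftOfBijective _ hb hp⟩)
  ext m
  refine eq_zero_of_two_smul_eq_zero (k := k) ?_
  have e₀ := LinearMap.congr_fun h₀ m
  have e₁ := LinearMap.congr_fun h₁ m
  simp only [LinearMap.add_apply, LinearMap.sub_apply, LinearMap.zero_apply] at e₀ e₁
  rw [sub_eq_zero] at e₁
  rwa [← e₁] at e₀

end RightSupermodule

/-! ### Irreducible supermodules over a semisimple superalgebra -/

namespace RightSupermodule

open MulOpposite

variable {k A : Type u} [Field k] [Ring A] [Algebra k A]
  {𝒜 : ZMod 2 → Submodule k A} [GradedAlgebra 𝒜]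

theorem exists_ne_zero_parity_eq_smul (M : RightSupermodule 𝒜) [Nontrivial M.carrier] :
    ∃ (m : M.carrier) (c : ℤˣ), m ≠ 0 ∧ M.parity m = c • m := by
  obtain ⟨m, hm⟩ := exists_ne (0 : M.carrier)
  obtain ⟨m₀, h₀, m₁, h₁, rfl⟩ := M.exists_eq_add m
  by_cases h : m₀ = 0
  · refine ⟨m₁, -1, ?_, by rw [parity_of_mem_one h₁, Units.neg_smul, one_smul]⟩
    rintro rfl
    exact hm (by rw [h, add_zero])
  · exact ⟨m₀, 1, h, by rw [parity_of_mem_zero h₀, one_smul]⟩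

theorem smul_parityConj {M : RightSupermodule 𝒜} (a : A) (m : M.carrier) :
    op (parityConj 𝒜 a) • m = M.parity (op a • M.parity m) := by
  rw [parity_smul, parity_parity]

variable [CharZero k]

/-! ### Endomorphisms of irreducible supermodules. -/

section Schur

variable {M : RightSupermodule 𝒜}

/-- A nonzero homogeneous vector generates a graded submodule, hence everything, so the supermodule
is a quotient of the regular module. -/
theorem finiteDimensional_of_isIrreducible [FiniteDimensional k A] (hM : M.IsIrreducible) :
    FiniteDimensional k M.carrier := by
  have := hM.1
  obtain ⟨m, c, hm, hc⟩ := M.exists_ne_zero_parity_eq_smul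
  have hg : M.IsGradedSubmodule (Submodule.span Aᵐᵒᵖ {m}) := isGradedSubmodule_iff.2 <| by
    intro x hx
    obtain ⟨a, rfl⟩ := Submodule.mem_span_singleton.1 hx
    induction a using MulOpposite.rec' with
    | h a =>
      rw [parity_smul, hc]
      refine Submodule.smul_mem _ _ ?_
      rcases Int.units_eq_one_or c with rfl | rfl
      · simp [Submodule.mem_span_singleton_self]
      · simp [Submodule.mem_span_singleton_self]
  have htop := (hM.2 _ hg).resolve_left fun h => hm (Submodule.span_singleton_eq_bot.1 h)
  have : Module.Finite k Aᵐᵒᵖ := Module.Finite.equiv (MulOpposite.opLinearEquiv k (M := A))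
  refine Module.Finite.of_surjective ((LinearMap.toSpanSingleton Aᵐᵒᵖ M.carrier m).restrictScalars k)
    fun x => ?_
  obtain ⟨a, ha⟩ := Submodule.mem_span_singleton.1 (htop ▸ Submodule.mem_top : x ∈ _)
  exact ⟨a, ha⟩

variable [IsAlgClosed k] [FiniteDimensional k A]

/-- Schur's lemma for even endomorphisms. -/
theorem exists_eq_smul_of_commute_parity (hM : M.IsIrreducible)
    (f : M.carrier →ₗ[Aᵐᵒᵖ] M.carrier) (hf : ∀ m, f (M.parity m) = M.parity (f m)) :
    ∃ c : k, ∀ m, f m = c • m := by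
  have := hM.1
  have := finiteDimensional_of_isIrreducible hM
  obtain ⟨c, hc⟩ := Module.End.exists_eigenvalue (f.restrictScalars k)
  obtain ⟨v, hv⟩ := hc.exists_hasEigenvector
  have hv1 : f v = c • v := hv.apply_eq_smul
  refine ⟨c, fun m => ?_⟩
  have h0 : f - c • LinearMap.id = 0 := by
    refine (eq_zero_or_bijective hM hM _ 1 fun m => ?_).resolve_right fun h => ?_
    · simp [hf]
    · exact hv.2 (h.1 (by simp [hv1]))
  simpa [sub_eq_zero] using LinearMap.congr_fun h0 m

/-- Odd endomorphisms are unique up to scalars. -/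
theorem exists_eq_smul_of_anticommute_parity (hM : M.IsIrreducible)
    (f g : M.carrier →ₗ[Aᵐᵒᵖ] M.carrier) (hf : ∀ m, f (M.parity m) = -M.parity (f m))
    (hg : ∀ m, g (M.parity m) = -M.parity (g m)) (h0 : f ≠ 0) : ∃ c : k, ∀ m, g m = c • f m := by
  have := hM.1
  have hbij := (eq_zero_or_bijective hM hM f (-1) fun m => by
    rw [hf, Units.neg_smul, one_smul]).resolve_left h0
  -- Composites of two odd maps are even, hence scalars; `f ∘ₗ f` is a nonzero scalar because `f` is
  -- injective, so it can be divided out.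
  obtain ⟨c, hc⟩ := exists_eq_smul_of_commute_parity hM (g ∘ₗ f) fun m => by simp [hf, hg]
  obtain ⟨d, hd⟩ := exists_eq_smul_of_commute_parity hM (f ∘ₗ f) fun m => by simp [hf]
  simp only [LinearMap.comp_apply] at hc hd
  have hd0 : d ≠ 0 := by
    rintro rfl
    obtain ⟨m, hm⟩ := exists_ne (0 : M.carrier)
    exact hm (hbij.1 (hbij.1 (by rw [hd]; simp)))
  refine ⟨d⁻¹ * c, fun m => ?_⟩
  have h1 := hc (f m)
  rw [hd, LinearMap.map_smul_of_tower] at h1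
  rw [mul_smul, ← h1, smul_smul, inv_mul_cancel₀ hd0, one_smul]

/-- Every endomorphism is the sum of a scalar and an odd endomorphism. -/
theorem exists_eq_smul_add_odd (hM : M.IsIrreducible) (f : M.carrier →ₗ[Aᵐᵒᵖ] M.carrier) :
    ∃ (c : k) (g : M.carrier →ₗ[Aᵐᵒᵖ] M.carrier), (∀ m, g (M.parity m) = -M.parity (g m)) ∧
      ∀ m, f m = c • m + g m := by
  obtain ⟨c, hc⟩ := exists_eq_smul_of_commute_parity hM (f + twist f) fun m => by
    simp [twist_apply, add_comm]
  refine ⟨2⁻¹ * c, (2⁻¹ : k) • (f - twist f), fun m => ?_, fun m => ?_⟩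
  · simp [twist_apply, ← smul_neg]
  · rw [mul_smul, ← hc, LinearMap.smul_apply, ← smul_add]
    simp only [LinearMap.add_apply, LinearMap.sub_apply]
    rw [add_add_sub_cancel, ← two_smul k, smul_smul, inv_mul_cancel₀ two_ne_zero, one_smul]

omit [IsAlgClosed k] [FiniteDimensional k A] in
theorem isSelfAssociate_iff (hM : M.IsIrreducible) : M.IsSelfAssociate ↔
    ∃ f : M.carrier →ₗ[Aᵐᵒᵖ] M.carrier, f ≠ 0 ∧ ∀ m, f (M.parity m) = -M.parity (f m) := by
  constructor
  · rintro ⟨e⟩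
    have := hM.1
    refine ⟨show M.carrier →ₗ[Aᵐᵒᵖ] M.carrier from e.toLinearEquiv.toLinearMap, fun h => ?_, fun m =>
      (e.map_parity m).trans (parityShift_parity _)⟩
    obtain ⟨m, hm⟩ := exists_ne (0 : M.carrier)
    exact hm (e.toLinearEquiv.injective ((LinearMap.congr_fun h m).trans (map_zero _).symm))
  · rintro ⟨f, hf0, hf⟩
    exact ⟨isoShiftOfBijective f ((eq_zero_or_bijective hM hM f (-1) fun m => by
      rw [hf, Units.neg_smul, one_smul]).resolve_left hf0) hf⟩

end Schur

/-- Right multiplication by `a` as an endomorphism, when it is one. -/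
def smulEnd (M : RightSupermodule 𝒜) (a : A) (ha : ∀ b, a * b = b * a) :
    M.carrier →ₗ[Aᵐᵒᵖ] M.carrier where
  toFun m := op a • m
  map_add' := smul_add _
  map_smul' b m := by
    induction b using MulOpposite.rec' with
    | h b => rw [smul_smul, ← op_mul, ← ha, op_mul, mul_smul]; rfl

/-! ### Joint faithfulness of the irreducible supermodules. -/

section Faithful

/-- A graded right ideal, as a supermodule. -/
def ofRightIdeal (I : Submodule Aᵐᵒᵖ A) (hI : ∀ x ∈ I, parityConj 𝒜 x ∈ I) :
    RightSupermodule 𝒜 where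
  carrier := I
  gr i := (𝒜 i).comap ((I.subtype).restrictScalars k)
  isCompl := by
    have h2 : ∀ x : A, x + x ∈ I → x ∈ I := fun x hx => by
      have := I.smul_of_tower_mem (2⁻¹ : k) hx
      rwa [← two_smul k, smul_smul, inv_mul_cancel₀ two_ne_zero, one_smul] at this
    constructor
    · rw [Submodule.disjoint_def]
      intro x h₀ h₁
      have h₀ : parityConj 𝒜 x.1 = x.1 := parityConj_of_mem_zero h₀
      have h₁ : parityConj 𝒜 x.1 = -x.1 := parityConj_of_mem_one h₁
      refine Subtype.ext (eq_zero_of_two_smul_eq_zero (k := k) ?_)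
      rw [add_eq_zero_iff_eq_neg, ← h₁, h₀]
    · rw [codisjoint_iff, eq_top_iff]
      rintro ⟨x, hx⟩ -
      obtain ⟨x₀, h₀, x₁, h₁, rfl⟩ := exists_eq_add_of_grading 𝒜 x
      have hp := hI _ hx
      rw [map_add, parityConj_of_mem_zero h₀, parityConj_of_mem_one h₁] at hp
      have m₀ : x₀ ∈ I := h2 _ (by convert I.add_mem hx hp using 1; abel)
      have m₁ : x₁ ∈ I := h2 _ (by convert I.sub_mem hx hp using 1; abel)
      exact Submodule.mem_sup.2 ⟨⟨x₀, m₀⟩, h₀, ⟨x₁, m₁⟩, h₁, rfl⟩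
  smul_mem i j m a hm ha := SetLike.mul_mem_graded (A := 𝒜) hm ha

theorem ofRightIdeal_parity (I : Submodule Aᵐᵒᵖ A) (hI : ∀ x ∈ I, parityConj 𝒜 x ∈ I) (x : I) :
    Subtype.val (p := (· ∈ I)) ((ofRightIdeal I hI).parity x) = parityConj 𝒜 x.1 := by
  obtain ⟨x₀, h₀, x₁, h₁, rfl⟩ := (ofRightIdeal I hI).exists_eq_add x
  refine (congrArg Subtype.val ((map_add _ _ _).trans
    (congrArg₂ (· + ·) (parity_of_mem_zero h₀) (parity_of_mem_one h₁)))).trans ?_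
  refine Eq.trans ?_ ((map_add (parityConj 𝒜) _ _).trans
    (congrArg₂ (· + ·) (parityConj_of_mem_zero h₀) (parityConj_of_mem_one h₁))).symm
  rfl

/-- Write $1 = e + c$ along a complement $C$ of $I$. For $x \in I$ the hypothesis gives $x = cx \in
C$, so $x = 0$. -/
theorem rightIdeal_eq_bot_of_mul_eq_zero [IsSemisimpleRing A] (I : Submodule Aᵐᵒᵖ A)
    (h : ∀ x ∈ I, ∀ y ∈ I, x * y = 0) : I = ⊥ := by
  have : IsSemisimpleModule Aᵐᵒᵖ A := inferInstance
  obtain ⟨C, hC⟩ := exists_isCompl I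
  obtain ⟨e, he, c, hc, hec⟩ := Submodule.mem_sup.1
    (hC.sup_eq_top ▸ Submodule.mem_top : (1 : A) ∈ I ⊔ C)
  rw [eq_bot_iff]
  intro x hx
  have hxc : x = c * x := by
    conv_lhs => rw [← one_mul x, ← hec, add_mul, h e he x hx, zero_add]
  have : x ∈ C := by
    rw [hxc]
    exact C.smul_mem (op x) hc
  exact hC.inf_eq_bot ▸ ⟨hx, this⟩

/-- If $a \ne 0$, a minimal nonzero graded right ideal $I \subseteq aA$ is an irreducible
supermodule, so $Ia = 0$ and $I \cdot I \subseteq IaA = 0$. Semisimplicity forbids this. Homogeneity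
of $a$ makes $aA$ graded. -/
theorem eq_zero_of_smul_eq_zero_of_homogeneous [IsSemisimpleRing A] [FiniteDimensional k A] (a : A) (c : ℤˣ)
    (hc : parityConj 𝒜 a = c • a)
    (h : ∀ M : RightSupermodule 𝒜, M.IsIrreducible → ∀ m : M.carrier, op a • m = 0) : a = 0 := by
  by_contra ha
  -- Multiplicativity of the parity involution is `parity_smul` for the regular supermodule.
  have hbar : ∀ x y : A, parityConj 𝒜 (x * y) = parityConj 𝒜 x * parityConj 𝒜 y := fun x y => by
    have := parity_smul (M := ofRightIdeal (𝒜 := 𝒜) ⊤ fun _ _ => trivial) y ⟨x, trivial⟩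
    have := congrArg Subtype.val this
    refine (ofRightIdeal_parity (𝒜 := 𝒜) ⊤ (fun _ _ => trivial) ⟨x * y, trivial⟩).symm.trans
      (this.trans ?_)
    exact congrArg (· * parityConj 𝒜 y)
      (ofRightIdeal_parity (𝒜 := 𝒜) ⊤ (fun _ _ => trivial) ⟨x, trivial⟩)
  let S : Set (Submodule Aᵐᵒᵖ A) :=
    {I | I ≠ ⊥ ∧ (∀ x ∈ I, parityConj 𝒜 x ∈ I) ∧ ∀ x ∈ I, ∃ b, x = a * b}
  have : IsArtinian Aᵐᵒᵖ A := isArtinian_of_tower k inferInstance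
  have hS : S.Nonempty := by
    refine ⟨Submodule.span Aᵐᵒᵖ {a}, fun h => ha (Submodule.span_singleton_eq_bot.1 h), ?_, ?_⟩
    · intro x hx
      obtain ⟨b, rfl⟩ := Submodule.mem_span_singleton.1 hx
      rw [show b • a = a * b.unop from rfl, hbar, hc]
      rcases Int.units_eq_one_or c with rfl | rfl
      · rw [one_smul]
        exact Submodule.mem_span_singleton.2 ⟨op _, rfl⟩
      · rw [Units.neg_smul, one_smul, neg_mul, ← mul_neg]
        exact Submodule.mem_span_singleton.2 ⟨op _, rfl⟩
    · intro x hx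
      obtain ⟨b, rfl⟩ := Submodule.mem_span_singleton.1 hx
      exact ⟨b.unop, rfl⟩
  obtain ⟨I, ⟨hI0, hIg, hIa⟩, hmin⟩ := (IsWellFounded.wf :
    WellFounded ((· < ·) : Submodule Aᵐᵒᵖ A → _ → Prop)).has_min S hS
  have hirr : (ofRightIdeal I hIg).IsIrreducible := by
    refine ⟨Submodule.nontrivial_iff_ne_bot.2 hI0, fun N hN => ?_⟩
    rw [isGradedSubmodule_iff] at hN
    let N' : Submodule Aᵐᵒᵖ I := N
    have hle : N'.map I.subtype ≤ I := Submodule.map_subtype_le I N'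
    by_cases hN0 : N' = ⊥
    · exact Or.inl hN0
    right
    have hmem : N'.map I.subtype ∈ S := by
      refine ⟨fun h0 => hN0 ?_, ?_, fun x hx => hIa x (hle hx)⟩
      · refine eq_bot_iff.2 fun x hx => Subtype.ext ?_
        exact (Submodule.mem_bot _).1 (h0 ▸ Submodule.mem_map_of_mem hx)
      · rintro _ ⟨x, hx, rfl⟩
        exact ⟨_, hN x hx, ofRightIdeal_parity I hIg x⟩
    have heq : N'.map I.subtype = I := (eq_or_lt_of_le hle).resolve_right (hmin _ hmem)
    change N' = ⊤
    rw [eq_top_iff]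
    rintro ⟨x, hx⟩ -
    rw [← heq] at hx
    obtain ⟨y, hy, rfl⟩ := hx
    exact hy
  refine hI0 (rightIdeal_eq_bot_of_mul_eq_zero I fun x hx y hy => ?_)
  obtain ⟨b, rfl⟩ := hIa y hy
  have : x * a = 0 := congrArg Subtype.val (h _ hirr ⟨x, hx⟩)
  rw [← mul_assoc, this, zero_mul]

/-- An element of a semisimple superalgebra which annihilates all irreducible supermodules
vanishes. -/
theorem eq_zero_of_smul_eq_zero [IsSemisimpleRing A] [FiniteDimensional k A]
    (a : A)
    (h : ∀ M : RightSupermodule 𝒜, M.IsIrreducible → ∀ m : M.carrier, op a • m = 0) : a = 0 := by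
  have hbar : ∀ M : RightSupermodule 𝒜, M.IsIrreducible → ∀ m : M.carrier,
      op (parityConj 𝒜 a) • m = 0 := fun M hM m => by
    rw [smul_parityConj, h M hM, map_zero]
  have h₀ : a + parityConj 𝒜 a = 0 :=
    eq_zero_of_smul_eq_zero_of_homogeneous (𝒜 := 𝒜) _ 1
      (by rw [map_add, parityConj_parityConj, one_smul, add_comm])
      fun M hM m => by rw [op_add, add_smul, h M hM, hbar M hM, add_zero]
  have h₁ : a - parityConj 𝒜 a = 0 :=
    eq_zero_of_smul_eq_zero_of_homogeneous (𝒜 := 𝒜) _ (-1)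
      (by rw [map_sub, parityConj_parityConj, Units.neg_smul, one_smul, neg_sub])
      fun M hM m => by rw [op_sub, sub_smul, h M hM, hbar M hM, sub_zero]
  rw [sub_eq_zero] at h₁
  rw [← h₁] at h₀
  exact eq_zero_of_two_smul_eq_zero (k := k) h₀

end Faithful

end RightSupermodule

/-! ### Density and the dimension count for central elements. -/

namespace RightSupermodule

open MulOpposite

variable {k A : Type u} [Field k] [Ring A] [Algebra k A]
  {𝒜 : ZMod 2 → Submodule k A} [GradedAlgebra 𝒜]
  [IsAlgClosed k] [CharZero k] [FiniteDimensional k A] [IsSemisimpleRing A]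

omit [IsAlgClosed k] in
/-- The density theorem for a finite family of irreducible supermodules which are pairwise
non-isomorphic up to shift: a family of central endomorphisms is given by an element of `A`. -/
theorem exists_smul_eq_of_central {ι : Type*} [Finite ι] (M : ι → RightSupermodule 𝒜)
    (hM : ∀ i, (M i).IsIrreducible) (hne : Pairwise fun i j => ¬ IsoUpToShift (M i) (M j))
    (T : ∀ i, (M i).carrier →ₗ[Aᵐᵒᵖ] (M i).carrier)
    (hT : ∀ i (f : (M i).carrier →ₗ[Aᵐᵒᵖ] (M i).carrier) m, T i (f m) = f (T i m)) :
    ∃ a : A, ∀ i m, T i m = op a • m := by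
  classical
  cases nonempty_fintype ι
  have hfd : ∀ i, FiniteDimensional k (M i).carrier := fun i =>
    finiteDimensional_of_isIrreducible (hM i)
  let V := ∀ i, (M i).carrier
  -- There are no nonzero maps between different members of the family, so endomorphisms of the
  -- product are diagonal.
  have hF : ∀ (F : V →ₗ[Aᵐᵒᵖ] V) (v : V) (i : ι), F v i = F (Pi.single i (v i)) i := by
    intro F v i
    conv_lhs => rw [← Finset.univ_sum_single v]
    rw [map_sum, Finset.sum_apply]
    refine Finset.sum_eq_single i (fun j _ hj => ?_) (fun h => absurd (Finset.mem_univ i) h)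
    exact LinearMap.congr_fun (eq_zero_of_not_isoUpToShift (hM j) (hM i) (hne hj)
      (LinearMap.proj i ∘ₗ F ∘ₗ LinearMap.single Aᵐᵒᵖ (fun i => (M i).carrier) j)) (v j)
  let T' : V →ₗ[Aᵐᵒᵖ] V := LinearMap.pi fun i => T i ∘ₗ LinearMap.proj i
  let TT : Module.End (Module.End Aᵐᵒᵖ V) V :=
    { toFun := T'
      map_add' := map_add T'
      map_smul' := fun F v => by
        funext i
        change T i (F v i) = F (T' v) i
        rw [hF F v, hF F (T' v)]
        exact hT i (LinearMap.proj i ∘ₗ F ∘ₗ LinearMap.single Aᵐᵒᵖ (fun i => (M i).carrier) i)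
          (v i) }
  -- Density matches `TT` only on finite sets, so it is applied to a finite set spanning `V` over
  -- `k`.
  obtain ⟨s, hs⟩ := Module.Finite.fg_top (R := k) (M := V)
  obtain ⟨r, hr⟩ := jacobson_density TT s
  have hall : ∀ v : V, T' v = r • v := fun v => by
    have hv : v ∈ Submodule.span k (s : Set V) := hs ▸ Submodule.mem_top
    induction hv using Submodule.span_induction with
    | mem v hv => exact hr v hv
    | zero => simp
    | add v w _ _ hv hw => rw [map_add, hv, hw, smul_add]
    | smul c v _ hv => rw [LinearMap.map_smul_of_tower, hv, smul_comm]
  refine ⟨unop r, fun i m => ?_⟩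
  have h := congrFun (hall (Pi.single i m)) i
  change T i ((Pi.single i m : V) i) = r • (Pi.single i m : V) i at h
  rwa [Pi.single_eq_same] at h

omit [IsAlgClosed k] in
/-- If `W` consists of the elements of `A` which act on the members `M i` of a complete finite
family by multiples of given central endomorphisms `T i`, then the dimension of `W` is the number
of the nonzero `T i`. -/
theorem finrank_eq_card_of_central {ι : Type*} [Finite ι] (M : ι → RightSupermodule 𝒜)
    (hM : ∀ i, (M i).IsIrreducible) (hne : Pairwise fun i j => ¬ IsoUpToShift (M i) (M j))
    (hfaith : ∀ a : A, (∀ i (m : (M i).carrier), op a • m = 0) → a = 0)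
    (T : ∀ i, (M i).carrier →ₗ[Aᵐᵒᵖ] (M i).carrier)
    (hT : ∀ i (f : (M i).carrier →ₗ[Aᵐᵒᵖ] (M i).carrier) m, T i (f m) = f (T i m))
    (W : Submodule k A) (hW : ∀ a, a ∈ W ↔ ∀ i, ∃ c : k, ∀ m, op a • m = c • T i m) :
    Module.finrank k W = Nat.card {i // T i ≠ 0} := by
  classical
  cases nonempty_fintype ι
  -- Density gives an element acting by `T i` on the member `i` and by zero on the others; those
  -- with `T i ≠ 0` will form a basis of `W`.
  have hex : ∀ i : ι, ∃ a : A, ∀ j (m : (M j).carrier), op a • m = if j = i then T j m else 0 := by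
    intro i
    obtain ⟨a, ha⟩ := exists_smul_eq_of_central M hM hne (fun j => if j = i then T j else 0)
      fun j f m => by
        split_ifs
        · exact hT j f m
        · simp
    refine ⟨a, fun j m => ?_⟩
    rw [← ha]
    split_ifs <;> rfl
  choose e he using hex
  let G : ({i // T i ≠ 0} → k) →ₗ[k] A := Fintype.linearCombination k fun i => e i.1
  have hG : ∀ (c : {i // T i ≠ 0} → k) (j) (m : (M j).carrier), op (G c) • m =
      if h : T j ≠ 0 then c ⟨j, h⟩ • T j m else 0 := by
    intro c j m
    have h1 : op (G c) • m = ∑ i : {i // T i ≠ 0}, c i • (if j = i then T j m else 0) := by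
      rw [Fintype.linearCombination_apply, Finset.op_sum, Finset.sum_smul]
      exact Finset.sum_congr rfl fun i _ => by rw [op_smul, smul_assoc, he]
    rw [h1]
    split_ifs with h
    · rw [Finset.sum_eq_single ⟨j, h⟩]
      · simp
      · intro i _ hi
        rw [if_neg, smul_zero]
        rintro rfl
        exact hi rfl
      · exact fun h' => absurd (Finset.mem_univ _) h'
    · refine Finset.sum_eq_zero fun i _ => ?_
      rw [if_neg, smul_zero]
      rintro rfl
      exact h i.2
  have hinj : Function.Injective G := by
    rw [← LinearMap.ker_eq_bot, eq_bot_iff]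
    intro c hc
    rw [LinearMap.mem_ker] at hc
    rw [Submodule.mem_bot]
    funext i
    by_contra hci
    refine i.2 (LinearMap.ext fun m => ?_)
    have := hG c i.1 m
    rw [hc, dif_pos i.2, op_zero, zero_smul] at this
    exact (smul_eq_zero.1 this.symm).resolve_left hci
  have hrange : LinearMap.range G = W := by
    ext a
    rw [hW]
    constructor
    · rintro ⟨c, rfl⟩ i
      by_cases h : T i ≠ 0
      · exact ⟨c ⟨i, h⟩, fun m => by rw [hG, dif_pos h]⟩
      · exact ⟨0, fun m => by rw [hG, dif_neg h, zero_smul]⟩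
    · intro h
      choose c hc using h
      refine ⟨fun i => c i, ?_⟩
      rw [← sub_eq_zero]
      refine hfaith _ fun i m => ?_
      rw [op_sub, sub_smul, hc, hG, sub_eq_zero]
      split_ifs with h
      · rfl
      · rw [not_not.1 h, LinearMap.zero_apply, smul_zero]
  rw [← hrange, LinearMap.finrank_range_of_inj hinj, Module.finrank_fintype_fun_eq_card,
    Nat.card_eq_fintype_card]

end RightSupermodule

/-! ### Counting irreducible classes by the graded centre. -/

namespace IrreducibleClass

open MulOpposite RightSupermodule

variable {k A : Type u} [Field k] [Ring A] [Algebra k A]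
  {𝒜 : ZMod 2 → Submodule k A} [GradedAlgebra 𝒜]

/-- A representative of a class. -/
noncomputable def rep (c : IrreducibleClass 𝒜) : RightSupermodule 𝒜 :=
  (Quotient.out (s := irreducibleSetoid 𝒜) c).1

theorem rep_isIrreducible (c : IrreducibleClass 𝒜) : c.rep.IsIrreducible :=
  (Quotient.out (s := irreducibleSetoid 𝒜) c).2

theorem eq_of_rep_isoUpToShift {c d : IrreducibleClass 𝒜} (h : IsoUpToShift c.rep d.rep) :
    c = d :=
  Quotient.out_equiv_out.1 h

theorem exists_isoUpToShift_rep {M : RightSupermodule 𝒜} (hM : M.IsIrreducible) :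
    ∃ c : IrreducibleClass 𝒜, IsoUpToShift c.rep M :=
  ⟨Quotient.mk (irreducibleSetoid 𝒜) ⟨M, hM⟩,
    Quotient.mk_out (s := irreducibleSetoid 𝒜) ⟨M, hM⟩⟩

theorem isSelfAssociate_iff (c : IrreducibleClass 𝒜) :
    c.IsSelfAssociate ↔ c.rep.IsSelfAssociate := by
  conv_lhs => rw [← Quotient.out_eq (s := irreducibleSetoid 𝒜) c]
  rfl

variable [IsAlgClosed k] [CharZero k] [FiniteDimensional k A] [IsSemisimpleRing A]

/-- Density separates any finite set of classes by elements acting as 1 on one of them and 0 on the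
others. These are linearly independent, so there are at most $\dim A$ classes. -/
instance finite : Finite (IrreducibleClass 𝒜) := by
  by_contra hinf
  rw [not_finite_iff_infinite] at hinf
  let f : Fin (Module.finrank k A + 1) → IrreducibleClass 𝒜 :=
    fun i => Infinite.natEmbedding _ i.1
  have hf : Function.Injective f := fun i j h => Fin.ext ((Infinite.natEmbedding _).injective h)
  have hM : ∀ i, (f i).rep.IsIrreducible := fun i => rep_isIrreducible _
  have hne : Pairwise fun i j => ¬ IsoUpToShift (f i).rep (f j).rep := fun i j hij h =>
    hij (hf (eq_of_rep_isoUpToShift h))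
  have hex : ∀ i, ∃ a : A, ∀ j (m : (f j).rep.carrier), op a • m = if j = i then m else 0 := by
    intro i
    obtain ⟨a, ha⟩ := exists_smul_eq_of_central (fun i => (f i).rep) hM hne
      (fun j => if j = i then LinearMap.id else 0)
      fun j f m => by split_ifs <;> simp
    refine ⟨a, fun j m => ?_⟩
    rw [← ha]
    split_ifs <;> rfl
  choose e he using hex
  have hli : LinearIndependent k e := by
    rw [Fintype.linearIndependent_iff]
    intro c hc i
    have := (hM i).1
    obtain ⟨m, hm⟩ := exists_ne (0 : (f i).rep.carrier)
    have h1 : op (∑ j, c j • e j) • m = c i • m := by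
      rw [Finset.op_sum, Finset.sum_smul, Finset.sum_eq_single i]
      · rw [op_smul, smul_assoc, he, if_pos rfl]
      · intro j _ hj
        rw [op_smul, smul_assoc, he, if_neg hj.symm, smul_zero]
      · exact fun h => absurd (Finset.mem_univ _) h
    rw [hc, op_zero, zero_smul] at h1
    exact (smul_eq_zero.1 h1.symm).resolve_right hm
  have := hli.fintype_card_le_finrank
  simp at this

omit [IsAlgClosed k] in
theorem eq_zero_of_rep (a : A) (h : ∀ (c : IrreducibleClass 𝒜) (m : c.rep.carrier), op a • m = 0) :
    a = 0 := by
  refine eq_zero_of_smul_eq_zero (𝒜 := 𝒜) a fun M hM m => ?_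
  have key : ∀ (c : IrreducibleClass 𝒜) (N : RightSupermodule 𝒜), Iso c.rep N →
      ∀ n : N.carrier, op a • n = 0 := fun c N e n => by
    have := congrArg e.toLinearEquiv (h c (e.toLinearEquiv.symm n))
    rwa [map_smul, map_zero, LinearEquiv.apply_symm_apply] at this
  obtain ⟨c, ⟨⟨e⟩⟩ | ⟨⟨e⟩⟩⟩ := exists_isoUpToShift_rep hM
  · exact key c _ e m
  · exact key c _ e m

-- The commutator of $a$ with any $b$ kills every irreducible, hence vanishes by faithfulness.
omit [IsAlgClosed k] in
theorem central_of_rep (a : A) (h : ∀ c : IrreducibleClass 𝒜,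
    ∃ f : c.rep.carrier →ₗ[Aᵐᵒᵖ] c.rep.carrier, ∀ m, op a • m = f m) (b : A) :
    a * b = b * a := by
  rw [← sub_eq_zero]
  refine eq_zero_of_rep (𝒜 := 𝒜) _ fun c m => ?_
  obtain ⟨f, hf⟩ := h c
  rw [op_sub, op_mul, op_mul, sub_smul, mul_smul, mul_smul, hf, hf, map_smul, sub_self]

/-- The even (for `d = 0`) or odd (for `d = 1`) part of the centre of a superalgebra. -/
def _root_.gradedCenter (𝒜 : ZMod 2 → Submodule k A) (d : ZMod 2) : Submodule k A :=
  (Subalgebra.center k A).toSubmodule ⊓ 𝒜 d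

omit [IsAlgClosed k] [CharZero k] [FiniteDimensional k A] [IsSemisimpleRing A]
  [GradedAlgebra 𝒜] in
theorem _root_.mem_gradedCenter {d : ZMod 2} {a : A} :
    a ∈ gradedCenter 𝒜 d ↔ (∀ b, a * b = b * a) ∧ a ∈ 𝒜 d := by
  simp only [gradedCenter, Submodule.mem_inf, Subalgebra.mem_toSubmodule,
    Subalgebra.mem_center_iff, eq_comm]

/-- The number of irreducible supermodules up to shift is the dimension of the even centre. -/
theorem card_eq_finrank_gradedCenter_zero :
    Nat.card (IrreducibleClass 𝒜) = Module.finrank k (gradedCenter 𝒜 0) := by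
  rw [finrank_eq_card_of_central (fun c : IrreducibleClass 𝒜 => c.rep) rep_isIrreducible
    (fun c d hcd h => hcd (eq_of_rep_isoUpToShift h)) eq_zero_of_rep (fun _ => LinearMap.id)
    (fun _ _ _ => rfl)]
  · refine (Nat.card_congr (Equiv.subtypeUnivEquiv fun c h => ?_)).symm
    have := c.rep_isIrreducible.1
    obtain ⟨m, hm⟩ := exists_ne (0 : c.rep.carrier)
    exact hm (LinearMap.congr_fun h m)
  · intro a
    rw [mem_gradedCenter]
    constructor
    · rintro ⟨hc, ha⟩ c
      refine exists_eq_smul_of_commute_parity c.rep_isIrreducible (c.rep.smulEnd a hc) fun m => ?_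
      change op a • c.rep.parity m = c.rep.parity (op a • m)
      rw [parity_smul, parityConj_of_mem_zero ha]
    · intro h
      refine ⟨central_of_rep (𝒜 := 𝒜) a fun c => ?_, mem_zero_iff_parityConj.2 ?_⟩
      · obtain ⟨x, hx⟩ := h c
        exact ⟨x • LinearMap.id, hx⟩
      · rw [← sub_eq_zero]
        refine eq_zero_of_rep (𝒜 := 𝒜) _ fun c m => ?_
        obtain ⟨x, hx⟩ := h c
        rw [op_sub, sub_smul, smul_parityConj, hx, hx]
        simp

/-- The number of self-associate irreducible supermodules up to shift is the dimension of the odd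
centre. -/
theorem card_isSelfAssociate_eq_finrank_gradedCenter_one :
    Nat.card {c : IrreducibleClass 𝒜 // c.IsSelfAssociate} =
      Module.finrank k (gradedCenter 𝒜 1) := by
  -- `T` spans the odd endomorphisms of the representative, and is 0 precisely when the class is not
  -- self-associate.
  have hT : ∀ c : IrreducibleClass 𝒜, ∃ T : c.rep.carrier →ₗ[Aᵐᵒᵖ] c.rep.carrier,
      (∀ m, T (c.rep.parity m) = -c.rep.parity (T m)) ∧ (T ≠ 0 ↔ c.IsSelfAssociate) ∧
      ∀ g : c.rep.carrier →ₗ[Aᵐᵒᵖ] c.rep.carrier, (∀ m, g (c.rep.parity m) = -c.rep.parity (g m)) →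
        ∃ x : k, ∀ m, g m = x • T m := by
    intro c
    have h := RightSupermodule.isSelfAssociate_iff c.rep_isIrreducible
    rw [IrreducibleClass.isSelfAssociate_iff, h]
    by_cases hc : c.rep.IsSelfAssociate
    · obtain ⟨f, hf0, hf⟩ := h.1 hc
      exact ⟨f, hf, ⟨fun _ => ⟨f, hf0, hf⟩, fun _ => hf0⟩, fun g hg =>
        exists_eq_smul_of_anticommute_parity c.rep_isIrreducible f g hf hg hf0⟩
    · refine ⟨0, by simp, ⟨fun h0 => absurd rfl h0, fun h1 => absurd (h.2 h1) hc⟩,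
        fun g hg => ⟨0, fun m => ?_⟩⟩
      by_contra hm
      exact hc (h.2 ⟨g, fun h0 => hm (by simp [h0]), hg⟩)
  choose T hTp hT0 hTg using hT
  rw [finrank_eq_card_of_central (fun c : IrreducibleClass 𝒜 => c.rep) rep_isIrreducible
    (fun c d hcd h => hcd (eq_of_rep_isoUpToShift h)) eq_zero_of_rep T]
  · exact Nat.card_congr (Equiv.subtypeEquivRight fun c => (hT0 c).symm)
  · intro c f m
    -- Every endomorphism is $x + yT$, so it commutes with $T$ although $T$ is odd.
    obtain ⟨x, g, hg, hfg⟩ := exists_eq_smul_add_odd c.rep_isIrreducible f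
    obtain ⟨y, hy⟩ := hTg c g hg
    simp only [hfg, hy, map_add, LinearMap.map_smul_of_tower]
  · intro a
    rw [mem_gradedCenter]
    constructor
    · rintro ⟨hc, ha⟩ c
      refine hTg c (c.rep.smulEnd a hc) fun m => ?_
      change op a • c.rep.parity m = -c.rep.parity (op a • m)
      rw [parity_smul, parityConj_of_mem_one ha, op_neg, neg_smul, neg_neg]
    · intro h
      refine ⟨central_of_rep (𝒜 := 𝒜) a fun c => ?_, mem_one_iff_parityConj.2 ?_⟩
      · obtain ⟨x, hx⟩ := h c
        exact ⟨x • T c, hx⟩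
      · rw [← sub_eq_zero, sub_neg_eq_add]
        refine eq_zero_of_rep (𝒜 := 𝒜) _ fun c m => ?_
        obtain ⟨x, hx⟩ := h c
        rw [op_add, add_smul, smul_parityConj, hx, hx, hTp]
        simp

end IrreducibleClass

/-! ### An upper bound for the dimension of the twisted group algebra -/

section BraidSpan

open scoped Pointwise

variable {k B : Type*} [Field k] [Ring B] [Algebra k B]

/-- The product `s m * s (m - 1) * ⋯ * s (m - t + 1)` of `t` factors with descending indices. -/
def descProd (s : ℕ → B) (m : ℕ) : ℕ → B
  | 0 => 1
  | t + 1 => descProd s m t * s (m - t)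

variable {s : ℕ → B} {m : ℕ}

/-- All factors have index at least $i + 2$, so $s_i$ passes each of them with a sign. -/
theorem descProd_mul_low (hanti : ∀ i j, i + 2 ≤ j → j ≤ m → s j * s i = -(s i * s j)) {i t : ℕ}
    (h : i + t < m) :
    descProd s m t * s i = s i * descProd s m t ∨ descProd s m t * s i = -(s i * descProd s m t) := by
  induction t with
  | zero => simp [descProd]
  | succ t ih =>
    have h1 : descProd s m (t + 1) * s i = -(descProd s m t * s i * s (m - t)) := by
      rw [descProd, mul_assoc, hanti i (m - t) (by omega) (by omega), mul_neg, mul_assoc]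
    rw [h1]
    rcases ih (by omega) with h2 | h2 <;> rw [h2] <;> simp [descProd, mul_assoc]

/-- The factor $s_{i+1}$ anticommutes with the factors of index below $i$, then meets $s_{i+1}s_i$,
where the braid relation turns it into $s_i$ on the left; this passes the factors of index at least
$i + 2$. -/
theorem descProd_mul_high (hanti : ∀ i j, i + 2 ≤ j → j ≤ m → s j * s i = -(s i * s j))
    (hbraid : ∀ i, i < m → s i * s (i + 1) * s i = s (i + 1) * s i * s (i + 1)) {i t : ℕ}
    (hi : i < m) (h : m + 1 ≤ i + t) (ht : t ≤ m + 1) :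
    descProd s m t * s (i + 1) = s i * descProd s m t ∨
      descProd s m t * s (i + 1) = -(s i * descProd s m t) := by
  induction t with
  | zero => omega
  | succ t ih =>
    by_cases h0 : m = i + t
    · obtain ⟨t, rfl⟩ : ∃ t', t = t' + 1 := ⟨t - 1, by omega⟩
      have e1 : m - t = i + 1 := by omega
      have e2 : m - (t + 1) = i := by omega
      have h1 : descProd s m (t + 2) * s (i + 1) = descProd s m t * s i * (s (i + 1) * s i) := by
        rw [descProd, descProd, e1, e2, mul_assoc, mul_assoc, ← mul_assoc (s (i + 1)),
          ← hbraid i hi]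
        simp only [mul_assoc]
      have h3 : descProd s m (t + 2) = descProd s m t * (s (i + 1) * s i) := by
        rw [descProd, descProd, e1, e2, mul_assoc]
      rw [h1, h3]
      rcases descProd_mul_low hanti (show i + t < m by omega) with h2 | h2 <;> rw [h2] <;>
        simp [mul_assoc]
    · have h1 : descProd s m (t + 1) * s (i + 1) = -(descProd s m t * s (i + 1) * s (m - t)) := by
        rw [descProd, mul_assoc, ← neg_neg (s (m - t) * s (i + 1)),
          ← hanti (m - t) (i + 1) (by omega) (by omega), mul_neg, mul_assoc]
      rw [h1]
      rcases ih (by omega) (by omega) with h2 | h2 <;> rw [h2] <;> simp [descProd, mul_assoc]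

/-- The span of all products of `m` generators subject to the relations of the twisted group
algebra of `S_{m+1}` has a spanning set with at most `(m + 1)!` elements. -/
theorem exists_finset_adjoin_le_span (k : Type*) [Field k] [Algebra k B] (s : ℕ → B) (m : ℕ)
    (hsq : ∀ i, i < m → s i * s i = -1)
    (hbraid : ∀ i, i + 1 < m → s i * s (i + 1) * s i = s (i + 1) * s i * s (i + 1))
    (hanti : ∀ i j, i + 2 ≤ j → j < m → s j * s i = -(s i * s j)) :
    ∃ F : Finset B, F.card ≤ (m + 1).factorial ∧
      Subalgebra.toSubmodule (Algebra.adjoin k (s '' Set.Iio m)) ≤ Submodule.span k (F : Set B) := by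
  classical
  induction m with
  | zero =>
    refine ⟨{1}, by simp, ?_⟩
    have : s '' Set.Iio 0 = ∅ := by simp
    rw [this, Algebra.adjoin_empty, Algebra.toSubmodule_bot, Submodule.one_eq_span]
    simp
  | succ m ih =>
    obtain ⟨F, hF, hle⟩ := ih (fun i h => hsq i (by omega)) (fun i h => hbraid i (by omega))
      (fun i j h h' => hanti i j h (by omega))
    set S := Subalgebra.toSubmodule (Algebra.adjoin k (s '' Set.Iio m)) with hS
    have hmemS : ∀ i, i < m → s i ∈ S := fun i hi =>
      Algebra.subset_adjoin (Set.mem_image_of_mem s (Set.mem_Iio.2 hi))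
    have h1S : (1 : B) ∈ S := Subalgebra.one_mem _
    -- The $m + 2$ descending products play the role of coset representatives of $S_{m+1}$ in
    -- $S_{m+2}$.
    let D : Finset B := (Finset.range (m + 2)).image (descProd s m)
    have hD : D.card ≤ m + 2 := Finset.card_image_le.trans (by simp)
    have hmemD : ∀ t, t ≤ m + 1 → descProd s m t ∈ Submodule.span k (D : Set B) := fun t ht =>
      Submodule.subset_span (Finset.mem_coe.2 (Finset.mem_image_of_mem _
        (Finset.mem_range.2 (by omega))))
    let V : Submodule k B := S * Submodule.span k (D : Set B)
    have hSV : S * V ≤ V := by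
      change S * (S * _) ≤ S * _
      rw [← mul_assoc]
      exact mul_le_mul' (Subalgebra.mul_toSubmodule_le _ _ |>.trans (by rw [sup_idem])) le_rfl
    have hanti' : ∀ i j, i + 2 ≤ j → j ≤ m → s j * s i = -(s i * s j) := fun i j h h' =>
      hanti i j h (by omega)
    have hbraid' : ∀ i, i < m → s i * s (i + 1) * s i = s (i + 1) * s i * s (i + 1) := fun i h =>
      hbraid i (by omega)
    have hDs : ∀ i t, i ≤ m → t ≤ m + 1 → descProd s m t * s i ∈ V := by
      intro i t hi ht
      have hmul : ∀ j, j < m → s j * descProd s m t ∈ V := fun j hj =>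
        Submodule.mul_mem_mul (hmemS j hj) (hmemD t ht)
      -- The generator $s_i$ passes through, lengthens the product when $i + t = m$, cancels its
      -- last factor when $i + t = m + 1$, or passes through with its index lowered by one.
      rcases lt_trichotomy (i + t) m with h | h | h
      · rcases descProd_mul_low hanti' h with h1 | h1 <;> rw [h1]
        · exact hmul i (by omega)
        · exact V.neg_mem (hmul i (by omega))
      · have h1 : descProd s m t * s i = 1 * descProd s m (t + 1) := by
          rw [one_mul, descProd, show m - t = i by omega]
        rw [h1]
        exact Submodule.mul_mem_mul h1S (hmemD _ (by omega))
      · rcases Nat.lt_or_ge (m + 1) (i + t) with h' | h'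
        · obtain ⟨i, rfl⟩ : ∃ i', i = i' + 1 := ⟨i - 1, by omega⟩
          rcases descProd_mul_high hanti' hbraid' (i := i) (t := t) (by omega) (by omega) ht
            with h1 | h1 <;> rw [h1]
          · exact hmul i (by omega)
          · exact V.neg_mem (hmul i (by omega))
        · obtain ⟨t, rfl⟩ : ∃ t', t = t' + 1 := ⟨t - 1, by omega⟩
          have h1 : descProd s m (t + 1) * s i = -(1 * descProd s m t) := by
            rw [descProd, show m - t = i by omega, mul_assoc, hsq i (by omega), mul_neg, mul_one,
              one_mul]
          rw [h1]
          exact V.neg_mem (Submodule.mul_mem_mul h1S (hmemD _ (by omega)))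
    have hVs : ∀ i, i ≤ m → ∀ v ∈ V, v * s i ∈ V := by
      intro i hi v hv
      have h1 : Submodule.span k (D : Set B) * Submodule.span k {s i} ≤ V := by
        rw [Submodule.span_mul_span, Submodule.span_le]
        rintro _ ⟨d, hd, _, rfl, rfl⟩
        obtain ⟨t, ht, rfl⟩ := Finset.mem_image.1 (Finset.mem_coe.1 hd)
        exact hDs i t hi (by have := Finset.mem_range.1 ht; omega)
      have h2 : V * Submodule.span k {s i} ≤ V := by
        refine le_trans ?_ hSV
        change S * _ * _ ≤ S * _
        rw [mul_assoc]
        exact mul_le_mul' le_rfl h1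
      exact h2 (Submodule.mul_mem_mul hv (Submodule.mem_span_singleton_self _))
    have hadj : Subalgebra.toSubmodule (Algebra.adjoin k (s '' Set.Iio (m + 1))) ≤ V := by
      rw [Algebra.adjoin_eq_span, Submodule.span_le]
      intro x hx
      induction hx using Submonoid.closure_induction_right with
      | one =>
        have := Submodule.mul_mem_mul h1S (hmemD 0 (by omega))
        rwa [descProd, one_mul] at this
      | mul_right x hx y hy ih =>
        obtain ⟨i, hi, rfl⟩ := hy
        exact hVs i (Nat.lt_succ_iff.1 hi) x ih
    refine ⟨F * D, ?_, hadj.trans ?_⟩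
    · refine Finset.card_mul_le.trans ((Nat.mul_le_mul hF hD).trans ?_)
      rw [Nat.factorial_succ (m + 1), mul_comm]
    · rw [Finset.coe_mul, ← Submodule.span_mul_span]
      exact mul_le_mul' hle le_rfl

end BraidSpan

namespace TwistedSymmetricGroup

variable (k : Type*) [Field k] (n : ℕ)

theorem adjoin_range_s : Algebra.adjoin k (Set.range (s k n)) = ⊤ := by
  have h := congrArg (Subalgebra.map (RingQuot.mkAlgHom k (Rel k n)))
    (FreeAlgebra.adjoin_range_ι (R := k) (X := Fin (n - 1)))
  rw [AlgHom.map_adjoin, ← Set.range_comp, Algebra.map_top,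
    (AlgHom.range_eq_top _).2 (RingQuot.mkAlgHom_surjective k (Rel k n))] at h
  exact h

theorem exists_finset_span_eq_top : ∃ F : Finset (Alg k n), F.card ≤ n.factorial ∧
    Submodule.span k (F : Set (Alg k n)) = ⊤ := by
  -- The value 0 beyond the last generator is a filler; only indices below `n - 1` are used.
  let s' : ℕ → Alg k n := fun i => if h : i < n - 1 then s k n ⟨i, h⟩ else 0
  have hs' : ∀ i (h : i < n - 1), s' i = s k n ⟨i, h⟩ := fun i h => dif_pos h
  obtain ⟨F, hF, hle⟩ := exists_finset_adjoin_le_span k s' (n - 1)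
    (fun i h => by rw [hs' i h, s_sq])
    (fun i h => by
      rw [hs' i (by omega), hs' (i + 1) h]
      exact s_braid k n _ _ rfl)
    (fun i j h h' => by
      rw [hs' i (by omega), hs' j h']
      exact s_anticomm k n _ _ (Or.inr h))
  refine ⟨F, hF.trans ?_, ?_⟩
  -- For $n = 0$ truncated subtraction gives $(n - 1 + 1)! = 1 = 0!$.
  · cases n <;> simp
  · have : s' '' Set.Iio (n - 1) = Set.range (s k n) := by
      ext x
      constructor
      · rintro ⟨i, hi, rfl⟩
        exact ⟨⟨i, hi⟩, (hs' i hi).symm⟩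
      · rintro ⟨i, rfl⟩
        exact ⟨i, i.2, hs' i i.2⟩
    rw [this, adjoin_range_s, Algebra.top_toSubmodule] at hle
    exact top_le_iff.1 hle

instance finiteDimensional : FiniteDimensional k (Alg k n) := by
  obtain ⟨F, -, hF⟩ := exists_finset_span_eq_top k n
  exact ⟨⟨F, hF⟩⟩

theorem finrank_le_factorial : Module.finrank k (Alg k n) ≤ n.factorial := by
  obtain ⟨F, hc, hF⟩ := exists_finset_span_eq_top k n
  rw [← finrank_top k (Alg k n), ← hF]
  exact (finrank_span_finset_le_card F).trans hc

end TwistedSymmetricGroup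

/-! ### The Clifford model and the basis of the twisted group algebra -/

namespace TwistedSymmetricGroup

open Equiv

/-- The adjacent transposition `(i, i + 1)`. -/
def adjSwap (n : ℕ) (i : Fin (n - 1)) : Perm (Fin n) :=
  swap ⟨i, by omega⟩ ⟨i + 1, by omega⟩

theorem adjSwap_mul_self (n : ℕ) (i : Fin (n - 1)) : adjSwap n i * adjSwap n i = 1 :=
  swap_mul_self _ _

theorem sign_adjSwap (n : ℕ) (i : Fin (n - 1)) : Perm.sign (adjSwap n i) = -1 :=
  Perm.sign_swap (by simp)

theorem swap_braid {α : Type*} [DecidableEq α] {x y z : α} (hxy : x ≠ y) (hxz : x ≠ z)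
    (hyz : y ≠ z) : swap x y * swap y z * swap x y = swap y z * swap x y * swap y z := by
  rw [swap_mul_swap_mul_swap hxy hxz, swap_comm x y, swap_comm y z,
    swap_mul_swap_mul_swap hyz.symm hxz.symm, swap_comm]

theorem adjSwap_braid (n : ℕ) (i j : Fin (n - 1)) (h : (i : ℕ) + 1 = j) :
    adjSwap n i * adjSwap n j * adjSwap n i = adjSwap n j * adjSwap n i * adjSwap n j := by
  obtain ⟨j, hj⟩ := j
  dsimp only at h
  subst h
  exact swap_braid (by simp) (by simp only [ne_eq, Fin.mk.injEq]; omega) (by simp)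

theorem adjSwap_comm (n : ℕ) (i j : Fin (n - 1)) (h : (i : ℕ) + 2 ≤ j ∨ (j : ℕ) + 2 ≤ i) :
    adjSwap n i * adjSwap n j = adjSwap n j * adjSwap n i := by
  refine (Perm.disjoint_swap_swap ?_).commute
  simp only [List.nodup_cons, List.mem_cons, Fin.mk.injEq, List.not_mem_nil, or_false,
    not_or, not_false_eq_true, List.nodup_nil, and_true]
  omega

theorem exists_word (n : ℕ) (σ : Perm (Fin n)) : ∃ l, (List.map (adjSwap n) l).prod = σ := by
  cases n with
  | zero => exact ⟨[], Subsingleton.elim _ _⟩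
  | succ n =>
    have h : σ ∈ Submonoid.closure (Set.range fun i : Fin n => swap i.castSucc i.succ) := by
      rw [Perm.mclosure_swap_castSucc_succ]
      exact Submonoid.mem_top σ
    induction h using Submonoid.closure_induction with
    | one => exact ⟨[], rfl⟩
    | mem x hx =>
      obtain ⟨i, rfl⟩ := hx
      refine ⟨[i], ?_⟩
      simp only [List.map_cons, List.map_nil, List.prod_cons, List.prod_nil, mul_one]
      rfl
    | mul x y _ _ hx hy =>
      obtain ⟨l, rfl⟩ := hx
      obtain ⟨m, rfl⟩ := hy
      exact ⟨l ++ m, by simp⟩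

/-! ### The simple roots as elements of a Clifford algebra. -/

section Clifford

variable (k : Type*) [Field k] (n : ℕ)

/-- The quadratic form `-(1/2) ∑ xᵢ²`, for which the roots `eᵢ - eⱼ` have value `-1`. -/
noncomputable def rootForm : QuadraticForm k (Fin n → k) :=
  QuadraticMap.weightedSumSquares k fun _ : Fin n => -(2⁻¹ : k)

theorem rootForm_apply (x : Fin n → k) : rootForm k n x = -(2⁻¹ * (x ⬝ᵥ x)) := by
  rw [rootForm, QuadraticMap.weightedSumSquares_apply, ← Finset.smul_sum, smul_eq_mul, neg_mul]
  rfl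

/-- The simple roots. -/
def simpleRoot (i : Fin (n - 1)) : Fin n → k :=
  Pi.single ⟨i, by omega⟩ 1 - Pi.single ⟨i + 1, by omega⟩ 1

variable {k n} [CharZero k]

theorem rootForm_simpleRoot (i : Fin (n - 1)) : rootForm k n (simpleRoot k n i) = -1 := by
  rw [rootForm_apply]
  simp only [simpleRoot, sub_dotProduct, single_dotProduct, Pi.sub_apply, Pi.single_apply,
    Fin.mk.injEq]
  norm_num

theorem polar_rootForm (x y : Fin n → k) :
    QuadraticMap.polar (rootForm k n) x y = -(x ⬝ᵥ y) := by
  simp only [QuadraticMap.polar, rootForm_apply, add_dotProduct, dotProduct_add,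
    dotProduct_comm y x]
  ring

theorem ι_simpleRoot_sq (i : Fin (n - 1)) :
    CliffordAlgebra.ι (rootForm k n) (simpleRoot k n i) *
      CliffordAlgebra.ι (rootForm k n) (simpleRoot k n i) = -1 := by
  rw [CliffordAlgebra.ι_sq_scalar, rootForm_simpleRoot, map_neg, map_one]

theorem ι_simpleRoot_anticomm (i j : Fin (n - 1)) (h : (i : ℕ) + 2 ≤ j ∨ (j : ℕ) + 2 ≤ i) :
    CliffordAlgebra.ι (rootForm k n) (simpleRoot k n i) *
        CliffordAlgebra.ι (rootForm k n) (simpleRoot k n j) =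
      -(CliffordAlgebra.ι (rootForm k n) (simpleRoot k n j) *
        CliffordAlgebra.ι (rootForm k n) (simpleRoot k n i)) := by
  have h0 : simpleRoot k n i ⬝ᵥ simpleRoot k n j = 0 := by
    simp only [simpleRoot, sub_dotProduct, single_dotProduct, Pi.sub_apply, Pi.single_apply,
      Fin.mk.injEq]
    rw [if_neg (by omega), if_neg (by omega), if_neg (by omega), if_neg (by omega)]
    simp
  rw [← add_eq_zero_iff_eq_neg, CliffordAlgebra.ι_mul_ι_add_swap, polar_rootForm, h0, neg_zero,
    map_zero]

/-- Adjacent simple roots have inner product $-1$, so $ab + ba = 1$. With $a^2 = b^2 = -1$ both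
$aba$ and $bab$ equal $a + b$. -/
theorem ι_simpleRoot_braid (i j : Fin (n - 1)) (h : (i : ℕ) + 1 = j) :
    CliffordAlgebra.ι (rootForm k n) (simpleRoot k n i) *
        CliffordAlgebra.ι (rootForm k n) (simpleRoot k n j) *
        CliffordAlgebra.ι (rootForm k n) (simpleRoot k n i) =
      CliffordAlgebra.ι (rootForm k n) (simpleRoot k n j) *
        CliffordAlgebra.ι (rootForm k n) (simpleRoot k n i) *
        CliffordAlgebra.ι (rootForm k n) (simpleRoot k n j) := by
  have h0 : simpleRoot k n i ⬝ᵥ simpleRoot k n j = -1 := by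
    simp only [simpleRoot, sub_dotProduct, single_dotProduct, Pi.sub_apply, Pi.single_apply,
      Fin.mk.injEq]
    rw [if_neg (by omega), if_neg (by omega), if_pos (by omega), if_neg (by omega)]
    simp
  have h1 := CliffordAlgebra.ι_mul_ι_add_swap (Q := rootForm k n) (simpleRoot k n i)
    (simpleRoot k n j)
  rw [polar_rootForm, h0, neg_neg, map_one] at h1
  have hi := ι_simpleRoot_sq (k := k) i
  have hj := ι_simpleRoot_sq (k := k) j
  generalize CliffordAlgebra.ι (rootForm k n) (simpleRoot k n i) = a at h1 hi ⊢
  generalize CliffordAlgebra.ι (rootForm k n) (simpleRoot k n j) = b at h1 hj ⊢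
  have hab : a * b = 1 - b * a := eq_sub_of_add_eq h1
  have hba : b * a = 1 - a * b := eq_sub_of_add_eq' h1
  rw [mul_assoc a, hba, mul_sub, ← mul_assoc, hi, sub_mul, mul_assoc a, hj]
  simp [add_comm]

variable (k n) in
/-- The homomorphism from the twisted group algebra to the group algebra of `S_n` over the
Clifford algebra. -/
noncomputable def cliffordHom :
    Alg k n →ₐ[k] MonoidAlgebra (CliffordAlgebra (rootForm k n)) (Perm (Fin n)) :=
  RingQuot.liftAlgHom k ⟨FreeAlgebra.lift k fun i => MonoidAlgebra.single (adjSwap n i)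
    (CliffordAlgebra.ι (rootForm k n) (simpleRoot k n i)), by
    intro x y h
    cases h with
    | sq i =>
      rw [map_mul, map_neg, map_one, FreeAlgebra.lift_ι_apply, MonoidAlgebra.single_mul_single,
        adjSwap_mul_self, ι_simpleRoot_sq, MonoidAlgebra.single_neg, MonoidAlgebra.one_def]
    | braid i j h =>
      simp only [map_mul, FreeAlgebra.lift_ι_apply, MonoidAlgebra.single_mul_single]
      rw [adjSwap_braid n i j h, ι_simpleRoot_braid i j h]
    | anticomm i j h =>
      simp only [map_mul, map_neg, FreeAlgebra.lift_ι_apply, MonoidAlgebra.single_mul_single]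
      rw [adjSwap_comm n i j h, ι_simpleRoot_anticomm i j h, MonoidAlgebra.single_neg]⟩

theorem cliffordHom_s (i : Fin (n - 1)) : cliffordHom k n (s k n i) =
    MonoidAlgebra.single (adjSwap n i)
      (CliffordAlgebra.ι (rootForm k n) (simpleRoot k n i)) := by
  rw [cliffordHom, s, RingQuot.liftAlgHom_mkAlgHom_apply, FreeAlgebra.lift_ι_apply]

end Clifford

/-! ### Lifts of permutations and the basis they form. -/

section Lift

variable (k : Type*) [Field k] {n : ℕ}

theorem mul_neg_alg (a b : Alg k n) : a * -b = -(a * b) := mul_neg a b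

theorem neg_mul_alg (a b : Alg k n) : -a * b = -(a * b) := neg_mul a b

theorem neg_neg_alg (a : Alg k n) : - -a = a := neg_neg a

/-- A product of generators of the twisted group algebra lifts the corresponding product of
adjacent transpositions. -/
def IsLift (x : Alg k n) (σ : Perm (Fin n)) : Prop :=
  ∃ l, (List.map (s k n) l).prod = x ∧ (List.map (adjSwap n) l).prod = σ

theorem exists_isLift (σ : Perm (Fin n)) : ∃ x : Alg k n, IsLift k x σ :=
  let ⟨l, hl⟩ := exists_word n σ
  ⟨_, l, rfl, hl⟩

/-- A chosen lift of a permutation. -/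
noncomputable def lift (σ : Perm (Fin n)) : Alg k n := (exists_isLift k σ).choose

theorem isLift_lift (σ : Perm (Fin n)) : IsLift k (lift k σ) σ := (exists_isLift k σ).choose_spec

variable {k} {x y : Alg k n} {σ τ : Perm (Fin n)}

theorem isLift_one : IsLift k (1 : Alg k n) 1 := ⟨[], rfl, rfl⟩

theorem isLift_s (i : Fin (n - 1)) : IsLift k (s k n i) (adjSwap n i) :=
  ⟨[i], by simp, by simp⟩

theorem IsLift.mul (hx : IsLift k x σ) (hy : IsLift k y τ) : IsLift k (x * y) (σ * τ) := by
  obtain ⟨l, rfl, rfl⟩ := hx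
  obtain ⟨m, rfl, rfl⟩ := hy
  exact ⟨l ++ m, by simp, by simp⟩

theorem IsLift.isUnit (hx : IsLift k x σ) : IsUnit x := by
  obtain ⟨l, rfl, -⟩ := hx
  refine List.prod_isUnit fun a ha => ?_
  obtain ⟨i, -, rfl⟩ := List.mem_map.1 ha
  exact ⟨⟨s k n i, -s k n i, by rw [mul_neg_alg, s_sq, neg_neg_alg],
    by rw [neg_mul_alg, s_sq, neg_neg_alg]⟩, rfl⟩

theorem IsLift.mem_grading (hx : IsLift k x σ) :
    ∃ d : ℕ, x ∈ grading k n d ∧ Perm.sign σ = (-1) ^ d := by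
  obtain ⟨l, rfl, rfl⟩ := hx
  refine ⟨l.length, prod_mem_grading k n l, ?_⟩
  rw [map_list_prod, List.map_map]
  induction l with
  | nil => rfl
  | cons i l ih =>
    rw [List.map_cons, List.prod_cons, ih, List.length_cons, pow_succ']
    simp [sign_adjSwap]

variable (k n) in
/-- The anti-automorphism `s_i ↦ -s_i`. -/
def conjugation : Alg k n →ₐ[k] (Alg k n)ᵐᵒᵖ :=
  RingQuot.liftAlgHom k ⟨FreeAlgebra.lift k fun i => MulOpposite.op (-s k n i), by
    intro x y h
    cases h with
    | sq i =>
      rw [map_mul, map_neg, map_one, FreeAlgebra.lift_ι_apply, ← MulOpposite.op_mul, neg_mul_alg,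
        mul_neg_alg, neg_neg_alg, s_sq, MulOpposite.op_neg, MulOpposite.op_one]
    | braid i j h =>
      simp only [map_mul, FreeAlgebra.lift_ι_apply, ← MulOpposite.op_mul, neg_mul_alg,
        mul_neg_alg, neg_neg_alg]
      rw [← mul_assoc, ← mul_assoc, s_braid k n i j h]
    | anticomm i j h =>
      simp only [map_mul, map_neg, FreeAlgebra.lift_ι_apply, ← MulOpposite.op_mul, neg_mul_alg,
        mul_neg_alg, neg_neg_alg]
      rw [s_anticomm k n j i h.symm, MulOpposite.op_neg]⟩

/-- A norm-one condition, since $s_i \cdot (-s_i) = 1$ telescopes. It later restricts the scalar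
between two lifts to $\pm 1$. -/
theorem IsLift.mul_conjugation (hx : IsLift k x σ) : x * (conjugation k n x).unop = 1 := by
  obtain ⟨l, rfl, -⟩ := hx
  induction l with
  | nil => simp
  | cons i l ih =>
    have hs : conjugation k n (s k n i) = MulOpposite.op (-s k n i) := by
      rw [conjugation, s, RingQuot.liftAlgHom_mkAlgHom_apply, FreeAlgebra.lift_ι_apply]
      rfl
    rw [List.map_cons, List.prod_cons, map_mul, hs, MulOpposite.unop_mul, MulOpposite.unop_op,
      mul_assoc, ← mul_assoc (List.prod _), ih, one_mul, mul_neg_alg, s_sq, neg_neg_alg]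

variable [CharZero k]

/-- The coefficient is a product of simple roots, each a unit in the Clifford algebra. -/
theorem IsLift.exists_cliffordHom (hx : IsLift k x σ) :
    ∃ t, t ≠ 0 ∧ cliffordHom k n x = MonoidAlgebra.single σ t := by
  -- Invertibility of 2 makes the Clifford algebra nontrivial, so that units are nonzero.
  let : Invertible (2 : k) := invertibleOfNonzero two_ne_zero
  suffices h : ∃ t, IsUnit t ∧ cliffordHom k n x = MonoidAlgebra.single σ t by
    obtain ⟨t, ht, h⟩ := h
    exact ⟨t, ht.ne_zero, h⟩
  obtain ⟨l, rfl, rfl⟩ := hx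
  induction l with
  | nil => exact ⟨1, isUnit_one, by simp [MonoidAlgebra.one_def]⟩
  | cons i l ih =>
    obtain ⟨t, ht, h⟩ := ih
    refine ⟨CliffordAlgebra.ι (rootForm k n) (simpleRoot k n i) * t, ?_, ?_⟩
    · refine IsUnit.mul ⟨⟨_, -CliffordAlgebra.ι (rootForm k n) (simpleRoot k n i), ?_, ?_⟩, rfl⟩ ht
      · rw [mul_neg, ι_simpleRoot_sq, neg_neg]
      · rw [neg_mul, ι_simpleRoot_sq, neg_neg]
    · rw [List.map_cons, List.prod_cons, map_mul, h, cliffordHom_s,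
        MonoidAlgebra.single_mul_single, List.map_cons, List.prod_cons]

variable (k n)

/-- The images under `cliffordHom` are nonzero and supported at distinct group elements. -/
theorem linearIndependent_lift : LinearIndependent k (lift k : Perm (Fin n) → Alg k n) := by
  rw [Fintype.linearIndependent_iff]
  intro c hc σ
  choose t ht0 ht using fun τ : Perm (Fin n) => (isLift_lift k τ).exists_cliffordHom
  have h := congrArg (fun z => (cliffordHom k n z).coeff σ) hc
  simp only [map_sum, map_smul, ht, map_zero] at h
  rw [MonoidAlgebra.coeff_sum, Finsupp.finsetSum_apply, Finset.sum_eq_single σ] at h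
  · rw [MonoidAlgebra.smul_single, MonoidAlgebra.coeff_single, Finsupp.single_apply, if_pos rfl] at h
    exact (smul_eq_zero.1 h).resolve_right (ht0 σ)
  · intro τ _ hτ
    rw [MonoidAlgebra.smul_single, MonoidAlgebra.coeff_single, Finsupp.single_apply, if_neg hτ]
  · exact fun h => absurd (Finset.mem_univ _) h

theorem card_perm_eq_finrank : Fintype.card (Perm (Fin n)) = Module.finrank k (Alg k n) :=
  le_antisymm (linearIndependent_lift k n).fintype_card_le_finrank
    (by rw [Fintype.card_perm, Fintype.card_fin]; exact finrank_le_factorial k n)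

/-- The basis of the twisted group algebra indexed by the symmetric group. -/
noncomputable def basis : Module.Basis (Perm (Fin n)) k (Alg k n) :=
  basisOfLinearIndependentOfCardEqFinrank (linearIndependent_lift k n) (card_perm_eq_finrank k n)

theorem basis_apply (σ : Perm (Fin n)) : basis k n σ = lift k σ := by
  simp [basis]

instance : Nontrivial (Alg k n) := ⟨_, 0, (linearIndependent_lift k n).ne_zero 1⟩

variable {k n}

/-- A lift of a permutation is unique up to sign. -/
theorem IsLift.eq_or_eq_neg (hx : IsLift k x σ) (hy : IsLift k y σ) : x = y ∨ x = -y := by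
  -- The image of `z` is supported at `σ` alone, so its coordinates at all other permutations
  -- vanish.
  have key : ∀ z : Alg k n, IsLift k z σ → z = (basis k n).repr z σ • lift k σ := by
    intro z hz
    choose t ht0 ht using fun τ : Perm (Fin n) => (isLift_lift k τ).exists_cliffordHom
    obtain ⟨u, -, hu⟩ := hz.exists_cliffordHom
    have hsum := (basis k n).sum_repr z
    have hco : ∀ τ, τ ≠ σ → (basis k n).repr z τ = 0 := by
      intro τ hτ
      have h := congrArg (fun z => (cliffordHom k n z).coeff τ) hsum
      simp only [map_sum, map_smul, basis_apply, ht, hu] at h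
      rw [MonoidAlgebra.coeff_sum, Finsupp.finsetSum_apply, Finset.sum_eq_single τ,
        MonoidAlgebra.coeff_single, Finsupp.single_apply, if_neg hτ.symm] at h
      · rw [MonoidAlgebra.smul_single, MonoidAlgebra.coeff_single, Finsupp.single_apply, if_pos rfl] at h
        exact (smul_eq_zero.1 h).resolve_right (ht0 τ)
      · intro ρ _ hρ
        rw [MonoidAlgebra.smul_single, MonoidAlgebra.coeff_single, Finsupp.single_apply, if_neg hρ]
      · exact fun h => absurd (Finset.mem_univ _) h
    conv_lhs => rw [← hsum]
    rw [Finset.sum_eq_single σ, basis_apply]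
    · intro τ _ hτ
      rw [hco τ hτ, zero_smul]
    · exact fun h => absurd (Finset.mem_univ _) h
  -- Both `z` and the chosen lift have norm 1, so the scalar relating them has square 1.
  have hsq : ∀ z : Alg k n, IsLift k z σ →
      (basis k n).repr z σ = 1 ∨ (basis k n).repr z σ = -1 := by
    intro z hz
    have h1 := hz.mul_conjugation
    rw [key z hz, map_smul, MulOpposite.unop_smul, smul_mul_smul_comm,
      (isLift_lift k σ).mul_conjugation, ← Algebra.algebraMap_eq_smul_one,
      ← map_one (algebraMap k (Alg k n))] at h1
    exact mul_self_eq_one_iff.1 ((algebraMap k (Alg k n)).injective h1)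
  have hneg : ∀ z : Alg k n, (-1 : k) • z = -z := fun z => neg_one_smul k z
  rw [key x hx, key y hy]
  rcases hsq x hx with h1 | h1 <;> rcases hsq y hy with h2 | h2 <;>
    simp only [h1, h2, hneg, one_smul, neg_neg_alg, true_or, or_true]

end Lift

end TwistedSymmetricGroup

/-! ### Twisted group algebras with signs -/

/-- A twisted group algebra of `G` whose multiplication is given by signs: a basis indexed by `G`
consisting of lifts, where lifts are multiplicative and unique up to sign. -/
structure LiftSystem (k A G : Type*) [Field k] [Ring A] [Algebra k A] [Group G] where
  IsLift : A → G → Prop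
  one : IsLift 1 1
  mul : ∀ {x y g h}, IsLift x g → IsLift y h → IsLift (x * y) (g * h)
  isUnit : ∀ {x g}, IsLift x g → IsUnit x
  eq_or_eq_neg : ∀ {x y g}, IsLift x g → IsLift y g → x = y ∨ x = -y
  basis : Module.Basis G k A
  isLift_basis : ∀ g, IsLift (basis g) g

namespace LiftSystem

theorem sign_smul_injective (k : Type*) {A : Type*} [Field k] [CharZero k] [Ring A] [Algebra k A]
    {u v : ℤˣ} {a : A} (ha : a ≠ 0)
    (h : u • a = v • a) : u = v := by
  have key : a ≠ -a := fun h => ha (eq_zero_of_two_smul_eq_zero (k := k)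
    (add_eq_zero_iff_eq_neg.2 h))
  rcases Int.units_eq_one_or u with rfl | rfl <;> rcases Int.units_eq_one_or v with rfl | rfl
  · rfl
  · rw [Units.neg_smul, one_smul] at h
    exact absurd h key
  · rw [Units.neg_smul, one_smul] at h
    exact absurd h.symm key
  · rfl

variable {k A G : Type*} [Field k] [Ring A] [Algebra k A] [Group G] (S : LiftSystem k A G)

theorem exists_eq_smul {x y : A} {g : G} (hx : S.IsLift x g) (hy : S.IsLift y g) :
    ∃ u : ℤˣ, x = u • y := by
  rcases S.eq_or_eq_neg hx hy with h | h
  · exact ⟨1, by rw [h, one_smul]⟩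
  · exact ⟨-1, by rw [h, Units.neg_smul, one_smul]⟩

theorem exists_mul_eq_one (g : G) : ∃ y : A, S.IsLift y g⁻¹ ∧ ∃ u : ℤˣ,
    S.basis g * y = u • 1 ∧ y * S.basis g = u • 1 := by
  have hy := S.isLift_basis g⁻¹
  have h1 := S.mul (S.isLift_basis g) hy
  rw [mul_inv_cancel] at h1
  obtain ⟨u, hu⟩ := S.exists_eq_smul h1 S.one
  refine ⟨_, hy, u, hu, ?_⟩
  refine (S.isUnit (S.isLift_basis g)).mul_left_cancel ?_
  rw [← mul_assoc, hu, smul_mul_assoc, mul_smul_comm, one_mul, mul_one]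

open Classical in
/-- The sign `u` such that lifts `x`, `y` of the commuting elements `g`, `h` satisfy
`x * y = u • (y * x)`. -/
noncomputable def eps (g h : G) : ℤˣ :=
  if S.basis g * S.basis h = S.basis h * S.basis g then 1 else -1

variable {S} {g g' h : G} {x y : A}

theorem mul_eq_eps_smul (hgh : Commute g h) (hx : S.IsLift x g) (hy : S.IsLift y h) :
    x * y = S.eps g h • (y * x) := by
  have h0 : S.basis g * S.basis h = S.eps g h • (S.basis h * S.basis g) := by
    rw [eps]
    split_ifs with he
    · rw [one_smul, he]
    · have h1 := S.mul (S.isLift_basis h) (S.isLift_basis g)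
      rw [← hgh.eq] at h1
      rw [Units.neg_smul, one_smul]
      exact (S.eq_or_eq_neg (S.mul (S.isLift_basis g) (S.isLift_basis h)) h1).resolve_left he
  obtain ⟨u, rfl⟩ := S.exists_eq_smul hx (S.isLift_basis g)
  obtain ⟨v, rfl⟩ := S.exists_eq_smul hy (S.isLift_basis h)
  rw [smul_mul_smul_comm, h0, smul_mul_smul_comm, smul_comm, mul_comm u v]

variable [CharZero k]

omit [CharZero k] in
theorem ne_zero (hx : S.IsLift x g) : x ≠ 0 := by
  intro h0
  have h1 := S.isUnit hx
  rw [h0, isUnit_zero_iff] at h1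
  exact S.basis.ne_zero 1 (by rw [← one_mul (S.basis 1), ← h1, zero_mul])

theorem eps_eq_of_mul_eq {u : ℤˣ} (hgh : Commute g h) (hx : S.IsLift x g) (hy : S.IsLift y h)
    (hu : x * y = u • (y * x)) : S.eps g h = u := by
  rw [mul_eq_eps_smul hgh hx hy] at hu
  exact sign_smul_injective k (ne_zero (S.mul hy hx)) hu

theorem eps_mul_left (h1 : Commute g h) (h2 : Commute g' h) :
    S.eps (g * g') h = S.eps g h * S.eps g' h := by
  have hg := S.isLift_basis g
  have hg' := S.isLift_basis g'
  have hh := S.isLift_basis h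
  refine eps_eq_of_mul_eq (h1.mul_left h2) (S.mul hg hg') hh ?_
  rw [mul_assoc, mul_eq_eps_smul h2 hg' hh, mul_smul_comm, ← mul_assoc, mul_eq_eps_smul h1 hg hh,
    smul_mul_assoc, smul_smul, mul_assoc, mul_comm (S.eps g' h)]

theorem eps_comm (h1 : Commute g h) : S.eps h g = S.eps g h := by
  have hg := S.isLift_basis g
  have hh := S.isLift_basis h
  refine eps_eq_of_mul_eq h1.symm hh hg ?_
  rw [mul_eq_eps_smul h1 hg hh, smul_smul, Int.units_mul_self, one_smul]

theorem eps_mul_right (h1 : Commute h g) (h2 : Commute h g') :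
    S.eps h (g * g') = S.eps h g * S.eps h g' := by
  rw [eps_comm (h1.mul_right h2).symm, eps_mul_left h1.symm h2.symm, eps_comm h1, eps_comm h2]

omit [CharZero k] in
@[simp] theorem eps_self : S.eps g g = 1 := by
  rw [eps, if_pos rfl]

theorem eps_one_left : S.eps 1 h = 1 :=
  eps_eq_of_mul_eq (Commute.one_left h) S.one (S.isLift_basis h) (by simp)

theorem eps_one_right : S.eps h 1 = 1 := by
  rw [eps_comm (Commute.one_left h), eps_one_left]

theorem eps_pow_right (h1 : Commute g h) (m : ℕ) : S.eps g (h ^ m) = S.eps g h ^ m := by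
  induction m with
  | zero => rw [pow_zero, pow_zero, eps_one_right]
  | succ m ih => rw [pow_succ, pow_succ, eps_mul_right (h1.pow_right m) h1, ih]

theorem eps_conj (h1 : Commute g h) (c : G) :
    S.eps (c * g * c⁻¹) (c * h * c⁻¹) = S.eps g h := by
  obtain ⟨w, hw, u, -, hu⟩ := S.exists_mul_eq_one c
  have hz := S.isLift_basis c
  have hg := S.isLift_basis g
  have hh := S.isLift_basis h
  have key : ∀ a b : A, S.basis c * a * w * (S.basis c * b * w) = u • (S.basis c * (a * b) * w) := by
    intro a b
    calc S.basis c * a * w * (S.basis c * b * w)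
        = S.basis c * a * (w * S.basis c) * b * w := by simp only [mul_assoc]
      _ = _ := by rw [hu]; simp only [mul_smul_comm, smul_mul_assoc, mul_one, mul_assoc]
  refine eps_eq_of_mul_eq ?_ (S.mul (S.mul hz hg) hw) (S.mul (S.mul hz hh) hw) ?_
  · have := congrArg (fun t => c * t * c⁻¹) h1.eq
    simpa [commute_iff_eq, mul_assoc] using this
  · rw [key, key, mul_eq_eps_smul h1 hg hh, mul_smul_comm, smul_mul_assoc, smul_comm]

/-- An element is split if its lifts commute with the lifts of all elements of its centralizer. -/
def IsSplit (S : LiftSystem k A G) (g : G) : Prop := ∀ h, Commute h g → S.eps h g = 1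

/-- The sign of $h$ against $g$ has $m$-th power 1, and $-1$ has no odd power equal to 1. -/
theorem isSplit_of_odd_pow_eq_one {m : ℕ} (hm : Odd m) (hg : g ^ m = 1) : S.IsSplit g := by
  intro h hh
  have h1 := eps_pow_right (S := S) hh m
  rw [hg, eps_one_right] at h1
  rcases Int.units_eq_one_or (S.eps h g) with h2 | h2
  · exact h2
  · rw [h2, hm.neg_one_pow] at h1
    exact absurd h1 (by decide)

/-- If `c` interchanges the commuting elements `g` and `h` and `c * c = 1`, then commuting the lift
of `c` past `g * h` has the same effect as commuting the lifts of `g` and `h`. -/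
theorem eps_mul_of_interchange {c : G} (hc : c * c = 1) (h1 : c * g = h * c) (h2 : c * h = g * c)
    (hgh : Commute g h) : S.eps c (g * h) = S.eps g h := by
  have hg := S.isLift_basis g
  have hh := S.isLift_basis h
  have hz := S.isLift_basis c
  obtain ⟨u, hu⟩ := S.exists_eq_smul (S.mul hz hg) (h1 ▸ S.mul hh hz)
  obtain ⟨v, hv⟩ := S.exists_eq_smul (S.mul hz hh) (h2 ▸ S.mul hg hz)
  obtain ⟨w, hw⟩ := S.exists_eq_smul (S.mul hz hz) (hc.symm ▸ S.one)
  -- Moving $g$ past $c$ twice costs the sign $uv$, but the lift of $c$ squares to a sign, which is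
  -- central.
  have huv : u * v = 1 := by
    refine sign_smul_injective k (a := S.basis g * (S.basis c * S.basis c))
      (ne_zero (S.mul hg (S.mul hz hz))) ?_
    calc (u * v) • (S.basis g * (S.basis c * S.basis c))
        = u • (v • (S.basis g * S.basis c)) * S.basis c := by
          rw [smul_smul, smul_mul_assoc, mul_assoc]
      _ = u • (S.basis c * (S.basis h * S.basis c)) := by
          rw [← hv, smul_mul_assoc, mul_assoc]
      _ = S.basis c * (S.basis c * S.basis g) := by rw [hu, mul_smul_comm]
      _ = S.basis c * S.basis c * S.basis g := (mul_assoc _ _ _).symm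
      _ = (1 : ℤˣ) • (S.basis g * (S.basis c * S.basis c)) := by
          rw [hw, smul_mul_assoc, mul_smul_comm, one_mul, mul_one, one_smul]
  refine eps_eq_of_mul_eq ?_ hz (S.mul hg hh) ?_
  · rw [commute_iff_eq, ← mul_assoc, h1, mul_assoc, h2, ← mul_assoc, hgh.eq]
  · calc S.basis c * (S.basis g * S.basis h)
        = u • (S.basis h * (S.basis c * S.basis h)) := by
          rw [← mul_assoc, hu, smul_mul_assoc, mul_assoc]
      _ = (u * v) • (S.basis h * S.basis g * S.basis c) := by
          rw [hv, mul_smul_comm, smul_smul, mul_assoc]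
      _ = S.eps g h • (S.basis g * S.basis h * S.basis c) := by
          rw [huv, one_smul, mul_eq_eps_smul hgh hg hh, smul_mul_assoc, smul_smul,
            Int.units_mul_self, one_smul]

end LiftSystem

/-! ### Lifts of permutations -/

namespace LiftSystem

open Equiv Equiv.Perm

variable {k A α : Type*} [Field k] [CharZero k] [Ring A] [Algebra k A] [Fintype α] [DecidableEq α]
  {S : LiftSystem k A (Perm α)}

/-- Lifts of disjoint transpositions anticommute. -/
def Anticommutes (S : LiftSystem k A (Perm α)) : Prop :=
  ∀ a b c d : α, [a, b, c, d].Nodup → S.eps (swap a b) (swap c d) = -1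

-- The sign is invariant under simultaneous conjugation, and the symmetric group is transitive on
-- quadruples of distinct points.
omit [Fintype α] in
theorem anticommutes_of_exists (a b c d : α) (hn : [a, b, c, d].Nodup)
    (h : S.eps (swap a b) (swap c d) = -1) : S.Anticommutes := by
  intro a' b' c' d' hn'
  have := MulAction.isMultiplyPretransitive_iff.1 (Equiv.Perm.isMultiplyPretransitive α 4)
    ⟨[a, b, c, d].get, List.nodup_iff_injective_get.1 hn⟩
    ⟨[a', b', c', d'].get, List.nodup_iff_injective_get.1 hn'⟩
  obtain ⟨g, hg⟩ := this
  have hg : ∀ i, g ([a, b, c, d].get i) = [a', b', c', d'].get i := fun i =>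
    DFunLike.congr_fun hg i
  have e0 : g a = a' := hg 0
  have e1 : g b = b' := hg 1
  have e2 : g c = c' := hg 2
  have e3 : g d = d' := hg 3
  rw [← e0, ← e1, ← e2, ← e3, swap_apply_apply, swap_apply_apply,
    eps_conj (disjoint_swap_swap hn).commute, h]

/-- Write `τ` as a product of transpositions avoiding `a` and `b`; each contributes $-1$. -/
theorem eps_swap (hS : S.Anticommutes) {a b : α} (hab : a ≠ b) {τ : Perm α} (ha : τ a = a)
    (hb : τ b = b) : S.eps (swap a b) τ = sign τ := by
  have hdisj : ∀ f : Perm {x // x ≠ a ∧ x ≠ b}, Disjoint (swap a b) (ofSubtype f) := fun f x => by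
    by_cases hx : x ≠ a ∧ x ≠ b
    · exact Or.inl (swap_apply_of_ne_of_ne hx.1 hx.2)
    · exact Or.inr (ofSubtype_apply_of_not_mem f hx)
  have key : ∀ f : Perm {x // x ≠ a ∧ x ≠ b}, S.eps (swap a b) (ofSubtype f) = sign f := by
    intro f
    induction f using swap_induction_on with
    | one => rw [map_one, map_one, eps_one_right]
    | swap_mul f x y hxy ih =>
      rw [map_mul, eps_mul_right (hdisj _).commute (hdisj _).commute, ih, ofSubtype_swap_eq,
        hS, Perm.sign_mul, sign_swap hxy]
      have hxy' : x.1 ≠ y.1 := fun h => hxy (Subtype.ext h)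
      have hx := x.2
      have hy := y.2
      simp only [List.nodup_cons, List.mem_cons, List.not_mem_nil, or_false, not_or]
      exact ⟨⟨hab, hx.1.symm, hy.1.symm⟩, ⟨hx.2.symm, hy.2.symm⟩, hxy', by simp⟩
  have hfix : ∀ x, (τ x ≠ a ∧ τ x ≠ b) ↔ (x ≠ a ∧ x ≠ b) := fun x => by
    have h1 : τ x = a ↔ x = a := by rw [← τ.apply_eq_iff_eq (x := x), ha]
    have h2 : τ x = b ↔ x = b := by rw [← τ.apply_eq_iff_eq (x := x), hb]
    rw [ne_eq, ne_eq, h1, h2]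
  have h1 := key (τ.subtypePerm hfix)
  have h2 : ofSubtype (τ.subtypePerm hfix) = τ :=
    ofSubtype_subtypePerm (p := fun x => x ≠ a ∧ x ≠ b) hfix fun x hx =>
    ⟨fun h => hx (h ▸ ha), fun h => hx (h ▸ hb)⟩
  rwa [← sign_ofSubtype, h2] at h1

/-- The sign is $-1$ exactly when both permutations are odd: write `σ` as a product of
transpositions of fixed points of `τ`, each contributing `sign τ`. -/
theorem eps_disjoint (hS : S.Anticommutes) {σ τ : Perm α} (h : Disjoint σ τ) :
    S.eps σ τ = if sign σ = 1 then 1 else sign τ := by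
  have hdisj : ∀ f : Perm {x // τ x = x}, Disjoint (ofSubtype f) τ := fun f x => by
    by_cases hx : τ x = x
    · exact Or.inr hx
    · exact Or.inl (ofSubtype_apply_of_not_mem f hx)
  have key : ∀ f : Perm {x // τ x = x},
      S.eps (ofSubtype f) τ = if sign f = 1 then 1 else sign τ := by
    intro f
    induction f using swap_induction_on with
    | one => rw [map_one, map_one, eps_one_left, if_pos rfl]
    | swap_mul f x y hxy ih =>
      rw [map_mul, eps_mul_left (hdisj _).commute (hdisj _).commute, ih, ofSubtype_swap_eq,
        eps_swap hS (fun h => hxy (Subtype.ext h)) x.2 y.2, Perm.sign_mul, sign_swap hxy]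
      rcases Int.units_eq_one_or (sign f) with h1 | h1 <;> rw [h1] <;> simp
  have hfix : ∀ x, τ (σ x) = σ x ↔ τ x = x := fun x => by
    rcases h x with h1 | h1
    · rw [h1]
    · have := congrArg (· x) h.commute.eq
      simp only [coe_mul, Function.comp_apply, h1] at this
      simp [h1, ← this]
  have h1 := key (σ.subtypePerm hfix)
  have h2 : ofSubtype (σ.subtypePerm hfix) = σ := ofSubtype_subtypePerm (p := fun x => τ x = x) hfix fun x hx =>
    (h x).resolve_left hx
  rwa [← sign_ofSubtype, h2] at h1

end LiftSystem

/-! ### Split conjugacy classes of the symmetric group. -/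

namespace LiftSystem

open Equiv Equiv.Perm

variable {k A α : Type*} [Field k] [CharZero k] [Ring A] [Algebra k A] [Fintype α] [DecidableEq α]
  {S : LiftSystem k A (Perm α)} {σ : Perm α}

theorem isSplit_of_forall_odd (h : ∀ i ∈ σ.cycleType, Odd i) : S.IsSplit σ := by
  have hprod : ∀ m : Multiset ℕ, (∀ i ∈ m, Odd i) → Odd m.prod := by
    intro m
    induction m using Multiset.induction_on with
    | empty => simp
    | cons a m ih =>
      intro hm
      rw [Multiset.prod_cons]
      exact (hm a (Multiset.mem_cons_self a m)).mul
        (ih fun i hi => hm i (Multiset.mem_cons_of_mem hi))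
  refine isSplit_of_odd_pow_eq_one (hprod _ h) (orderOf_dvd_iff_pow_eq_one.1 ?_)
  rw [← lcm_cycleType, Multiset.lcm_dvd]
  exact fun b hb => Multiset.dvd_prod hb

theorem commute_of_mem_cycleFactorsFinset {c : Perm α} (hc : c ∈ σ.cycleFactorsFinset) :
    Commute c σ := by
  have := self_mem_cycle_factors_commute hc
  exact this

/-- Remove `c` from `σ`: its lift commutes with itself, and the rest is disjoint from `c`. -/
theorem eps_cycleFactor (hS : S.Anticommutes) {c : Perm α} (hc : c ∈ σ.cycleFactorsFinset) :
    S.eps c σ = if sign c = 1 then 1 else sign σ * sign c := by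
  have hd := (disjoint_mul_inv_of_mem_cycleFactorsFinset hc).symm
  have h1 : S.eps c (σ * c⁻¹ * c) = S.eps c (σ * c⁻¹) * S.eps c c :=
    eps_mul_right hd.commute (Commute.refl c)
  rw [inv_mul_cancel_right, eps_self, mul_one] at h1
  rw [h1, eps_disjoint hS hd, Perm.sign_mul, sign_inv]

/-- A cycle of even length is an odd permutation, so it anticommutes with the even `σ` it belongs
to. -/
theorem isSplit_iff_of_sign_eq_one (hS : S.Anticommutes) (hσ : sign σ = 1) :
    S.IsSplit σ ↔ ∀ i ∈ σ.cycleType, Odd i := by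
  refine ⟨fun h i hi => ?_, isSplit_of_forall_odd⟩
  rw [cycleType_def, Multiset.mem_map] at hi
  obtain ⟨c, hc, rfl⟩ := hi
  have hc : c ∈ σ.cycleFactorsFinset := hc
  have h1 := h c (commute_of_mem_cycleFactorsFinset hc)
  rw [eps_cycleFactor hS hc, hσ, one_mul, (mem_cycleFactorsFinset_iff.1 hc).1.sign] at h1
  by_contra hodd
  rw [Function.comp_apply, Nat.not_odd_iff_even] at hodd
  rw [hodd.neg_one_pow] at h1
  exact absurd h1 (by decide)

/-- With distinct cycle lengths and at most one fixed point, the centralizer is generated by the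
cycles of `σ`. Each has trivial sign: an even cycle by `eps_cycleFactor` directly, an odd one
because $(-1)(-1) = 1$. -/
theorem isSplit_of_sign_eq_neg_one (hS : S.Anticommutes) (hσ : sign σ = -1)
    (hct : σ.cycleType.Nodup) (hfix : Fintype.card α ≤ σ.support.card + 1) : S.IsSplit σ := by
  let H : Subgroup (Perm α) :=
    { carrier := {τ | Commute τ σ ∧ S.eps τ σ = 1}
      one_mem' := ⟨Commute.one_left σ, eps_one_left⟩
      mul_mem' := fun h1 h2 => ⟨h1.1.mul_left h2.1, by
        rw [eps_mul_left h1.1 h2.1, h1.2, h2.2, one_mul]⟩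
      inv_mem' := fun {τ} h1 => by
        have h2 : Commute τ⁻¹ σ := h1.1.inv_left
        refine ⟨h2, ?_⟩
        have h3 := eps_mul_left (S := S) h2 h1.1
        rwa [inv_mul_cancel, eps_one_left, h1.2, mul_one, eq_comm] at h3 }
  have hsub : Subsingleton (Function.fixedPoints σ) := by
    rw [← Fintype.card_le_one_iff_subsingleton, card_fixedPoints, sum_cycleType]
    omega
  have hle : (OnCycleFactors.kerParam σ).range ≤ H := by
    rw [OnCycleFactors.kerParam, MonoidHom.noncommCoprod_range, sup_le_iff,
      Subgroup.noncommPiCoprod_range, iSup_le_iff]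
    constructor
    · rintro _ ⟨u, rfl⟩
      rw [Subsingleton.elim u 1, map_one]
      exact H.one_mem
    · intro c
      rw [Subgroup.zpowers_le]
      refine ⟨commute_of_mem_cycleFactorsFinset c.2, ?_⟩
      rw [eps_cycleFactor hS c.2, hσ]
      rcases Int.units_eq_one_or (sign c.1) with h | h <;> rw [h] <;> simp
  intro τ hτ
  rw [Equiv.Perm.OnCycleFactors.kerParam_range_eq_centralizer_of_count_le_one
    (Multiset.nodup_iff_count_le_one.1 hct)] at hle
  exact (hle (Subgroup.mem_centralizer_singleton_iff.2 hτ)).2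

/-- Two cycles of the same length can be interchanged by an involution in the centralizer. -/
theorem exists_interchange {c d : Perm α} (hc : c ∈ σ.cycleFactorsFinset)
    (hd : d ∈ σ.cycleFactorsFinset) (hcd : c ≠ d) (hcard : c.support.card = d.support.card) :
    ∃ τ : Perm α, Commute τ σ ∧ τ * τ = 1 ∧ τ * c = d * τ ∧ τ * d = c * τ ∧
      τ.support = c.support ∪ d.support ∧ sign τ = (-1) ^ c.support.card := by
  let ρ : Perm σ.cycleFactorsFinset := swap ⟨c, hc⟩ ⟨d, hd⟩
  have hne : (⟨c, hc⟩ : σ.cycleFactorsFinset) ≠ ⟨d, hd⟩ := fun h => hcd (congrArg Subtype.val h)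
  obtain ⟨a⟩ := Equiv.Perm.Basis.nonempty σ
  have hρ : ρ ∈ OnCycleFactors.range_toPermHom' σ := fun x ↦ by
    by_cases hx : x = ⟨c, hc⟩
    · rw [hx, swap_apply_left]; exact hcard.symm
    by_cases hx' : x = ⟨d, hd⟩
    · rw [hx', swap_apply_right]; exact hcard
    · rw [swap_apply_of_ne_of_ne hx hx']
  set τ := a.toCentralizer ⟨ρ, hρ⟩ with hτ
  have hsq : τ ^ 2 = 1 := by
    rw [hτ, ← map_pow]
    convert! MonoidHom.map_one _
    rw [← Subtype.coe_inj]
    exact (pow_two _).trans (swap_mul_self _ _)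
  have hsq' : (τ : Perm α) ^ 2 = 1 := by
    rw [← Subgroup.coe_pow, hsq, Subgroup.coe_one]
  have hperm : ∀ x : σ.cycleFactorsFinset, (τ : Perm α) * x = ρ x * τ := fun x => by
    have h1 := OnCycleFactors.coe_toPermHom σ τ x
    rw [hτ, Basis.toPermHom_apply_toCentralizer] at h1
    rw [h1, ← hτ, inv_mul_cancel_right]
  have hsupp : (τ : Perm α).support = c.support ∪ d.support := by
    have h1 := Basis.ofPermHom_support a ⟨ρ, hρ⟩
    refine h1.trans ?_
    simp only [ρ, support_swap hne]
    rw [Finset.biUnion_insert, Finset.singleton_biUnion]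
  have hdisj : _root_.Disjoint c.support d.support :=
    (cycleFactorsFinset_pairwise_disjoint σ hc hd hcd).disjoint_support
  refine ⟨τ, Subgroup.mem_centralizer_singleton_iff.1 τ.2, by rw [← pow_two, hsq'], ?_, ?_, hsupp,
    ?_⟩
  · have := hperm ⟨c, hc⟩
    rwa [show ρ ⟨c, hc⟩ = ⟨d, hd⟩ from swap_apply_left _ _] at this
  · have := hperm ⟨d, hd⟩
    rwa [show ρ ⟨d, hd⟩ = ⟨c, hc⟩ from swap_apply_right _ _] at this
  -- An involution moving $2|c|$ points is a product of $|c|$ transpositions.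
  · have hct : (τ : Perm α).cycleType = Multiset.replicate (τ : Perm α).cycleType.card 2 := by
      rw [Multiset.eq_replicate_card, ← pow_prime_eq_one_iff, hsq']
    have hcard2 : (τ : Perm α).cycleType.card * 2 = (τ : Perm α).support.card := by
      rw [← sum_cycleType, hct]
      simp
    rw [hsupp, Finset.card_union_of_disjoint hdisj, ← hcard, ← mul_two] at hcard2
    have hcard3 := Nat.eq_of_mul_eq_mul_right two_pos hcard2
    rw [sign_of_cycleType, hct, Multiset.sum_replicate, Multiset.card_replicate, hcard3, pow_add,
      smul_eq_mul, mul_comm _ 2, pow_mul]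
    simp

/-- Let $\tau$ be the involution interchanging two cycles $c, d$ of length $\ell$. Against the odd
permutation $\sigma(cd)^{-1}$ it has sign $(-1)^\ell$; against $cd$ its sign is that of $c$ against
$d$, namely $(-1)^{\ell-1}$. The product is always $-1$. -/
theorem not_isSplit_of_not_nodup (hS : S.Anticommutes) (hσ : sign σ = -1)
    (hct : ¬ σ.cycleType.Nodup) : ¬ S.IsSplit σ := by
  rw [cycleType_def, Multiset.nodup_map_iff_inj_on σ.cycleFactorsFinset.nodup] at hct
  push Not at hct
  obtain ⟨c, hc, d, hd, hcard, hcd⟩ := hct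
  have hc : c ∈ σ.cycleFactorsFinset := hc
  have hd : d ∈ σ.cycleFactorsFinset := hd
  have hcard : c.support.card = d.support.card := hcard
  obtain ⟨τ, hτσ, hτ2, hτc, hτd, hsupp, hsign⟩ := exists_interchange hc hd hcd hcard
  intro hsplit
  have hcd' : Disjoint c d := cycleFactorsFinset_pairwise_disjoint σ hc hd hcd
  have hsc := (mem_cycleFactorsFinset_iff.1 hc).1.sign
  have hsd := (mem_cycleFactorsFinset_iff.1 hd).1.sign
  have hρ : Disjoint τ (σ * (c * d)⁻¹) := by
    have h1 := disjoint_mul_inv_of_mem_cycleFactorsFinset hc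
    have h2 := disjoint_mul_inv_of_mem_cycleFactorsFinset hd
    have e1 : σ * (c * d)⁻¹ = σ * c⁻¹ * d⁻¹ := by
      rw [hcd'.commute.eq, mul_inv_rev, mul_assoc]
    have e2 : σ * (c * d)⁻¹ = σ * d⁻¹ * c⁻¹ := by rw [mul_inv_rev, mul_assoc]
    intro x
    by_cases hx : x ∈ τ.support
    · right
      rw [hsupp, Finset.mem_union, mem_support, mem_support] at hx
      rcases hx with hx | hx
      · have hdx : d x = x := (hcd' x).resolve_left hx
        rw [e1, mul_apply, inv_eq_iff_eq.2 hdx.symm]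
        exact (h1 x).resolve_right hx
      · have hcx : c x = x := (hcd' x).resolve_right hx
        rw [e2, mul_apply, inv_eq_iff_eq.2 hcx.symm]
        exact (h2 x).resolve_right hx
    · exact Or.inl (notMem_support.1 hx)
  have hτcd : Commute τ (c * d) := by
    rw [commute_iff_eq, ← mul_assoc, hτc, mul_assoc, hτd, ← mul_assoc, hcd'.commute.eq]
  have h1 := hsplit τ hτσ
  have h2 : S.eps τ (σ * (c * d)⁻¹ * (c * d)) =
      S.eps τ (σ * (c * d)⁻¹) * S.eps τ (c * d) := eps_mul_right hρ.commute hτcd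
  rw [inv_mul_cancel_right, h1, eps_mul_of_interchange hτ2 hτc hτd hcd'.commute,
    eps_disjoint hS hρ, eps_disjoint hS hcd', Perm.sign_mul, sign_inv, Perm.sign_mul, hσ, hsign,
    hsd, hsc, ← hcard] at h2
  rcases neg_one_pow_eq_or ℤˣ c.support.card with h | h <;> rw [h] at h2 <;>
    exact absurd h2 (by decide)

theorem isSplit_iff_of_sign_eq_neg_one (hS : S.Anticommutes) (hσ : sign σ = -1) :
    S.IsSplit σ ↔ σ.partition.parts.Nodup := by
  have hone : 1 ∉ σ.cycleType := fun h => absurd (two_le_of_mem_cycleType h) (by decide)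
  rw [parts_partition, Multiset.nodup_add]
  have hrep : (Multiset.replicate (Fintype.card α - σ.support.card) 1).Nodup ↔
      Fintype.card α ≤ σ.support.card + 1 := by
    rw [Multiset.nodup_iff_count_le_one]
    constructor
    · intro h
      have := h 1
      rw [Multiset.count_replicate_self] at this
      omega
    · intro h a
      refine (Multiset.count_le_card _ _).trans ?_
      rw [Multiset.card_replicate]
      omega
  have hdisj : _root_.Disjoint σ.cycleType
      (Multiset.replicate (Fintype.card α - σ.support.card) 1) := by
    rw [Multiset.disjoint_left]
    intro a ha hb
    rw [Multiset.eq_of_mem_replicate hb] at ha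
    exact hone ha
  rw [hrep]
  refine ⟨fun h => ⟨?_, ?_, hdisj⟩, fun h => isSplit_of_sign_eq_neg_one hS hσ h.1 h.2.1⟩
  · by_contra hct
    exact not_isSplit_of_not_nodup hS hσ hct h
  -- Two fixed points of `σ` give a transposition in the centralizer, which anticommutes with the
  -- odd `σ`.
  · by_contra hfix
    have h2 : 1 < (Finset.univ \ σ.support).card := by
      rw [Finset.card_sdiff_of_subset (Finset.subset_univ _), Finset.card_univ]
      omega
    obtain ⟨a, ha, b, hb, hab⟩ := Finset.one_lt_card.1 h2
    have ha : σ a = a := by simpa using ha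
    have hb : σ b = b := by simpa using hb
    have hcomm : Commute (swap a b) σ := by
      refine Disjoint.commute fun x => ?_
      by_cases hxa : x = a
      · exact Or.inr (hxa ▸ ha)
      by_cases hxb : x = b
      · exact Or.inr (hxb ▸ hb)
      · exact Or.inl (swap_apply_of_ne_of_ne hxa hxb)
    have h1 := h _ hcomm
    rw [eps_swap hS hab ha hb, hσ] at h1
    exact absurd h1 (by decide)

end LiftSystem

/-! ### The centre of a twisted group algebra -/

namespace LiftSystem

variable {k A G : Type*} [Field k] [CharZero k] [Ring A] [Algebra k A] [Group G]
  {S : LiftSystem k A G}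

omit [CharZero k] in
theorem exists_conj_eq_smul (S : LiftSystem k A G) (c g : G) :
    ∃ u : ℤˣ, S.basis c * S.basis g = u • (S.basis (c * g * c⁻¹) * S.basis c) := by
  refine S.exists_eq_smul (S.mul (S.isLift_basis c) (S.isLift_basis g)) ?_
  have := S.mul (S.isLift_basis (c * g * c⁻¹)) (S.isLift_basis c)
  rwa [inv_mul_cancel_right] at this

/-- The sign by which conjugation by a lift of `c` acts on the chosen lift of `g`. -/
noncomputable def conjSign (S : LiftSystem k A G) (c g : G) : ℤˣ :=
  (S.exists_conj_eq_smul c g).choose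

omit [CharZero k] in
theorem basis_mul_basis_eq (c g : G) :
    S.basis c * S.basis g = S.conjSign c g • (S.basis (c * g * c⁻¹) * S.basis c) :=
  (S.exists_conj_eq_smul c g).choose_spec

theorem conjSign_of_commute {c g : G} (h : Commute c g) : S.conjSign c g = S.eps c g := by
  have h1 := basis_mul_basis_eq (S := S) c g
  rw [show c * g * c⁻¹ = g by rw [h.eq, mul_inv_cancel_right]] at h1
  exact (eps_eq_of_mul_eq h (S.isLift_basis c) (S.isLift_basis g) h1).symm

variable [Finite G]

omit [CharZero k] in
theorem repr_conj_of_central {z : A} (hz : ∀ b, z * b = b * z) (c g : G) :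
    S.basis.repr z (c * g * c⁻¹) = S.conjSign c g • S.basis.repr z g := by
  classical
  cases nonempty_fintype G
  have h1 : (∑ h, S.basis.repr z h • S.conjSign c h • S.basis (c * h * c⁻¹)) = z := by
    refine (S.isUnit (S.isLift_basis c)).mul_right_cancel ?_
    rw [hz]
    conv_rhs => rw [← S.basis.sum_repr z]
    rw [Finset.sum_mul, Finset.mul_sum]
    refine Finset.sum_congr rfl fun h _ => ?_
    rw [mul_smul_comm, basis_mul_basis_eq, smul_mul_assoc, smul_mul_assoc]
  have h2 := congrArg (fun y => S.basis.repr y (c * g * c⁻¹)) h1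
  simp only [map_sum, map_smul, Finsupp.finsetSum_apply, Finsupp.smul_apply] at h2
  rw [← h2, Finset.sum_eq_single g]
  · rw [Units.smul_def, map_zsmul, Module.Basis.repr_self, Finsupp.smul_apply,
      Finsupp.single_eq_same, ← Units.smul_def, smul_comm, smul_eq_mul, mul_one]
  · intro h _ hne
    rw [Units.smul_def, map_zsmul, Module.Basis.repr_self, Finsupp.smul_apply,
      Finsupp.single_eq_of_ne, smul_zero, smul_zero]
    intro he
    exact hne (by simpa using he.symm)
  · exact fun h => absurd (Finset.mem_univ g) h

/-- Some centralizing element conjugates the lift of $g$ to its negative, so the coefficient equals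
its own negative. -/
theorem repr_eq_zero_of_not_isSplit {z : A} (hz : ∀ b, z * b = b * z) {g : G}
    (hg : ¬ S.IsSplit g) : S.basis.repr z g = 0 := by
  rw [IsSplit] at hg
  push Not at hg
  obtain ⟨c, hc, he⟩ := hg
  have h1 := repr_conj_of_central (S := S) hz c g
  rw [show c * g * c⁻¹ = g by rw [hc.eq, mul_inv_cancel_right], conjSign_of_commute hc,
    (Int.units_eq_one_or _).resolve_left he, Units.neg_smul, one_smul] at h1
  exact self_eq_neg.1 h1

omit [CharZero k] in
theorem central_of_commute_basis {z : A} (hz : ∀ g, z * S.basis g = S.basis g * z) (b : A) :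
    z * b = b * z := by
  cases nonempty_fintype G
  rw [← S.basis.sum_repr b, Finset.mul_sum, Finset.sum_mul]
  exact Finset.sum_congr rfl fun g _ => by rw [mul_smul_comm, smul_mul_assoc, hz]

/-- A split element has a central class sum, with nonzero coefficient at that element. -/
theorem exists_central (g : G) (hg : S.IsSplit g) : ∃ z : A, (∀ b, z * b = b * z) ∧
    S.basis.repr z g ≠ 0 ∧ ∀ h, ¬ IsConj g h → S.basis.repr z h = 0 := by
  classical
  cases nonempty_fintype G
  let T : G → Aˣ := fun c => (S.isUnit (S.isLift_basis c)).unit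
  have hT : ∀ c, (T c : A) = S.basis c := fun c => rfl
  have hconj : ∀ c h, (T c : A) * S.basis h * ↑(T c)⁻¹ =
      S.conjSign c h • S.basis (c * h * c⁻¹) := fun c h => by
    rw [Units.mul_inv_eq_iff_eq_mul, hT, basis_mul_basis_eq, smul_mul_assoc]
  let z : A := ∑ c, (T c : A) * S.basis g * ↑(T c)⁻¹
  have hrepr : ∀ h, S.basis.repr z h =
      ∑ c, if c * g * c⁻¹ = h then S.conjSign c g • (1 : k) else 0 := fun h => by
    simp only [z, hconj, map_sum, Finsupp.finsetSum_apply, Units.smul_def, map_zsmul,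
      Module.Basis.repr_self, Finsupp.smul_apply, Finsupp.single_apply]
    exact Finset.sum_congr rfl fun c _ => by split_ifs <;> simp
  refine ⟨z, central_of_commute_basis (S := S) fun h => ?_, ?_, ?_⟩
  · have key : ∀ c, S.basis h * ((T c : A) * S.basis g * ↑(T c)⁻¹) =
        (T (h * c) : A) * S.basis g * ↑(T (h * c))⁻¹ * S.basis h := fun c => by
      obtain ⟨u, hu⟩ := S.exists_eq_smul (S.mul (S.isLift_basis h) (S.isLift_basis c))
        (S.isLift_basis (h * c))
      have hu' : (T (h * c) : A) = u • ((T h : A) * T c) := by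
        rw [hT, hT, hT, hu, smul_smul, Int.units_mul_self, one_smul]
      rw [← hT h, ← Units.mul_inv_eq_iff_eq_mul, Units.eq_mul_inv_iff_mul_eq, hu', mul_smul_comm,
        smul_mul_assoc]
      congr 1
      simp [mul_assoc]
    rw [Finset.mul_sum, Finset.sum_mul]
    simp only [key]
    exact (Equiv.sum_comp (Equiv.mulLeft h)
      (fun c => (T c : A) * S.basis g * ↑(T c)⁻¹ * S.basis h)).symm
  -- All signs over the centralizer are 1, so the coefficient is the centralizer's order, nonzero in
  -- characteristic 0.
  · rw [hrepr, Finset.sum_congr rfl (g := fun c => if c * g * c⁻¹ = g then (1 : k) else 0),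
      Finset.sum_boole, Nat.cast_ne_zero, Finset.card_ne_zero]
    · exact ⟨1, by simp⟩
    · intro c _
      split_ifs with h
      · have hc : Commute c g := mul_inv_eq_iff_eq_mul.1 h
        rw [conjSign_of_commute hc, hg c hc, one_smul]
      · rfl
  · intro h hh
    rw [hrepr]
    refine Finset.sum_eq_zero fun c _ => if_neg fun he => hh (isConj_iff.2 ⟨c, he⟩)

/-- The dimension of the part of the centre supported on a union of conjugacy classes is the number
of the split classes it contains. -/
theorem finrank_central_eq_card (P : G → Prop) (hP : ∀ g h, IsConj g h → P g → P h)
    (W : Submodule k A)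
    (hW : ∀ a, a ∈ W ↔ (∀ b, a * b = b * a) ∧ ∀ g, ¬ P g → S.basis.repr a g = 0) :
    Module.finrank k W =
      Nat.card {c : ConjClasses G // ∃ g, ConjClasses.mk g = c ∧ P g ∧ S.IsSplit g} := by
  classical
  cases nonempty_fintype G
  let I := {c : ConjClasses G // ∃ g, ConjClasses.mk g = c ∧ P g ∧ S.IsSplit g}
  have : Finite I := inferInstance
  cases nonempty_fintype I
  choose r hr hrP hrS using fun c : I => c.2
  choose z hzc hz0 hzn using fun c : I => exists_central (S := S) (r c) (hrS c)
  have hconj : ∀ c d : I, c ≠ d → ¬ IsConj (r c) (r d) := fun c d hcd h => hcd (Subtype.ext (by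
    rw [← hr c, ← hr d]
    exact ConjClasses.mk_eq_mk_iff_isConj.2 h))
  have hzW : ∀ c, z c ∈ W := fun c => (hW _).2 ⟨hzc c, fun g hg => hzn c g fun h =>
    hg (hP _ _ h (hrP c))⟩
  -- An element of `W` is determined by its coefficients at one representative per split class, and
  -- the class sums `z c` realise all values.
  let F : W →ₗ[k] (I → k) := LinearMap.pi fun c =>
    (Finsupp.lapply (r c)) ∘ₗ S.basis.repr.toLinearMap ∘ₗ W.subtype
  have hF : ∀ w c, F w c = S.basis.repr w.1 (r c) := fun _ _ => rfl
  have hinj : Function.Injective F := by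
    rw [← LinearMap.ker_eq_bot, eq_bot_iff]
    intro w hw
    rw [LinearMap.mem_ker] at hw
    rw [Submodule.mem_bot]
    have hwW := (hW _).1 w.2
    refine Subtype.ext (S.basis.repr.injective (Finsupp.ext fun g => ?_))
    rw [ZeroMemClass.coe_zero, map_zero, Finsupp.zero_apply]
    by_cases hg : P g
    · by_cases hs : S.IsSplit g
      · let c : I := ⟨ConjClasses.mk g, g, rfl, hg, hs⟩
        have h1 : IsConj (r c) g := ConjClasses.mk_eq_mk_iff_isConj.1 (hr c)
        obtain ⟨x, hx⟩ := isConj_iff.1 h1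
        rw [← hx, repr_conj_of_central hwW.1, ← hF, hw, Pi.zero_apply, smul_zero]
      · exact repr_eq_zero_of_not_isSplit hwW.1 hs
    · exact hwW.2 g hg
  have hsurj : Function.Surjective F := by
    intro f
    refine ⟨∑ c, (f c / S.basis.repr (z c) (r c)) • ⟨z c, hzW c⟩, ?_⟩
    funext d
    rw [map_sum, Finset.sum_apply, Finset.sum_eq_single d]
    · rw [map_smul, Pi.smul_apply, hF, smul_eq_mul, div_mul_cancel₀ _ (hz0 d)]
    · intro c _ hcd
      rw [map_smul, Pi.smul_apply, hF, hzn c _ (hconj c d hcd), smul_zero]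
    · exact fun h => absurd (Finset.mem_univ _) h
  rw [(LinearEquiv.ofBijective F ⟨hinj, hsurj⟩).finrank_eq, Module.finrank_fintype_fun_eq_card,
    Nat.card_eq_fintype_card]

/-! ### Semisimplicity -/

-- Left multiplication permutes the basis up to signs, without fixed points.
omit [CharZero k] in
theorem trace_mulLeft_eq_zero {x : A} {g : G} (hx : S.IsLift x g) (hg : g ≠ 1) :
    LinearMap.trace k A (LinearMap.mulLeft k x) = 0 := by
  classical
  cases nonempty_fintype G
  rw [LinearMap.trace_eq_matrix_trace k S.basis]
  refine Finset.sum_eq_zero fun h _ => ?_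
  obtain ⟨u, hu⟩ := S.exists_eq_smul (S.mul hx (S.isLift_basis h)) (S.isLift_basis (g * h))
  rw [Matrix.diag_apply, LinearMap.toMatrix_apply, LinearMap.mulLeft_apply, hu, Units.smul_def,
    map_zsmul, Module.Basis.repr_self, Finsupp.smul_apply, Finsupp.single_eq_of_ne, smul_zero]
  intro h1
  exact hg (by simpa using h1.symm)

/-- For $a$ in the radical and $y$ a lift of $g^{-1}$, left multiplication by $ay$ is nilpotent and
has trace 0. That trace is $\pm|G|$ times the coefficient of $a$ at $g$. -/
theorem isSemisimpleRing (S : LiftSystem k A G) : IsSemisimpleRing A := by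
  classical
  cases nonempty_fintype G
  have : Module.Finite k A := Module.Finite.of_basis S.basis
  have : IsArtinianRing A := IsArtinianRing.of_finite k A
  rw [IsArtinianRing.isSemisimpleRing_iff_jacobson, eq_bot_iff]
  intro a ha
  rw [Submodule.mem_bot]
  refine S.basis.repr.injective (Finsupp.ext fun g => ?_)
  rw [map_zero, Finsupp.zero_apply]
  obtain ⟨y, hy, u, hu, -⟩ := S.exists_mul_eq_one g
  have hnil : IsNilpotent (a * y) := by
    obtain ⟨N, hN⟩ := IsArtinianRing.isNilpotent_jacobson_bot (R := A)
    have hmem : a * y ∈ Ideal.jacobson (⊥ : Ideal A) := by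
      rw [Ideal.jacobson_bot]
      exact Ideal.mul_mem_right _ _ ha
    exact ⟨N, by simpa [hN] using Ideal.pow_mem_pow hmem N⟩
  have htr : LinearMap.trace k A (LinearMap.mulLeft k (a * y)) = 0 :=
    (LinearMap.isNilpotent_trace_of_isNilpotent
      (hnil.map (Algebra.lmul k A))).eq_zero
  have hexp : LinearMap.mulLeft k (a * y) =
      ∑ h, S.basis.repr a h • LinearMap.mulLeft k (S.basis h * y) := by
    ext b
    simp only [LinearMap.mulLeft_apply, LinearMap.sum_apply, LinearMap.smul_apply, mul_assoc,
      ← smul_mul_assoc]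
    rw [← Finset.sum_mul, S.basis.sum_repr]
  rw [hexp, map_sum, Finset.sum_eq_single g, map_smul, hu] at htr
  · have h1 : LinearMap.mulLeft k (u • (1 : A)) = (u : ℤ) • LinearMap.id := by
      ext b
      simp [Units.smul_def]
    rw [h1, map_zsmul, LinearMap.trace_id, smul_eq_zero] at htr
    refine htr.resolve_right (smul_ne_zero u.ne_zero (Nat.cast_ne_zero.2 ?_))
    rw [Module.finrank_eq_card_basis S.basis]
    exact Fintype.card_ne_zero
  · intro h _ hne
    rw [map_smul, trace_mulLeft_eq_zero (S.mul (S.isLift_basis h) hy), smul_zero]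
    rwa [ne_eq, mul_inv_eq_one]
  · exact fun h => absurd (Finset.mem_univ _) h

end LiftSystem

/-! ### Conjugacy classes of permutations and partitions -/

section Partitions

open Equiv Equiv.Perm

variable {n : ℕ}

/-- The cycle type of a permutation of `Fin n`, including fixed points, as a partition of `n`. -/
def permPartition (σ : Perm (Fin n)) : n.Partition where
  parts := σ.partition.parts
  parts_pos := σ.partition.parts_pos
  parts_sum := σ.partition.parts_sum.trans (Fintype.card_fin n)

theorem permPartition_parts (σ : Perm (Fin n)) : (permPartition σ).parts = σ.partition.parts := rfl

theorem permPartition_eq_iff {σ τ : Perm (Fin n)} :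
    permPartition σ = permPartition τ ↔ IsConj σ τ := by
  rw [partition_eq_of_isConj, Nat.Partition.ext_iff, Nat.Partition.ext_iff, permPartition_parts,
    permPartition_parts]

theorem permPartition_surjective : Function.Surjective (permPartition (n := n)) := by
  intro p
  have hle : (p.parts.filter (2 ≤ ·)).sum ≤ Fintype.card (Fin n) := by
    refine le_of_le_of_eq ?_ (p.parts_sum.trans (Fintype.card_fin n).symm)
    conv_rhs => rw [← Multiset.filter_add_not (2 ≤ ·) p.parts, Multiset.sum_add]
    exact Nat.le_add_right _ _
  obtain ⟨σ, hσ⟩ := (exists_with_cycleType_iff (Fin n) (m := p.parts.filter (2 ≤ ·))).2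
    ⟨hle, fun a ha => (Multiset.mem_filter.1 ha).2⟩
  refine ⟨σ, Nat.Partition.ext ?_⟩
  rw [permPartition_parts, parts_partition, hσ, ← sum_cycleType, hσ, Fintype.card_fin]
  conv_rhs => rw [← Multiset.filter_add_not (2 ≤ ·) p.parts]
  congr 1
  have h1 : p.parts.filter (fun i => ¬ 2 ≤ i) =
      Multiset.replicate (p.parts.filter (fun i => ¬ 2 ≤ i)).card 1 := by
    rw [Multiset.eq_replicate_card]
    intro i hi
    have h2 := (Multiset.mem_filter.1 hi).2
    have h3 := p.parts_pos (Multiset.mem_filter.1 hi).1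
    omega
  have h2 : n = (p.parts.filter (2 ≤ ·)).sum + (p.parts.filter (fun i => ¬ 2 ≤ i)).card := by
    conv_lhs => rw [← p.parts_sum, ← Multiset.filter_add_not (2 ≤ ·) p.parts, Multiset.sum_add, h1]
    simp
  rw [h1]
  congr 1
  omega

/-- Conjugacy classes of permutations correspond to partitions. -/
noncomputable def conjClassesEquivPartition : ConjClasses (Perm (Fin n)) ≃ n.Partition :=
  Equiv.ofBijective (Quotient.lift permPartition fun _ _ h => permPartition_eq_iff.2 h) <| by
    constructor
    · intro a b
      induction a using Quotient.inductionOn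
      induction b using Quotient.inductionOn
      exact fun h => Quotient.sound (permPartition_eq_iff.1 h)
    · exact fun p => (permPartition_surjective p).elim fun σ hσ => ⟨ConjClasses.mk σ, hσ⟩

theorem card_conjClasses_eq_card_partition (Q : Perm (Fin n) → Prop) (R : n.Partition → Prop)
    (h : ∀ σ, (∃ τ, IsConj τ σ ∧ Q τ) ↔ R (permPartition σ)) :
    Nat.card {c : ConjClasses (Perm (Fin n)) // ∃ τ, ConjClasses.mk τ = c ∧ Q τ} =
      Nat.card {p // R p} := by
  refine Nat.card_congr (conjClassesEquivPartition.subtypeEquiv fun c => ?_)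
  obtain ⟨σ, rfl⟩ := ConjClasses.mk_surjective c
  refine Iff.trans ?_ (h σ)
  simp only [ConjClasses.mk_eq_mk_iff_isConj]

theorem forall_odd_parts_iff (σ : Perm (Fin n)) :
    (∀ i ∈ (permPartition σ).parts, Odd i) ↔ ∀ i ∈ σ.cycleType, Odd i := by
  rw [permPartition_parts, parts_partition]
  refine ⟨fun h i hi => h i (Multiset.mem_add.2 (Or.inl hi)), fun h i hi => ?_⟩
  rcases Multiset.mem_add.1 hi with hi | hi
  · exact h i hi
  · rw [Multiset.eq_of_mem_replicate hi]
    exact odd_one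

theorem sign_eq_one_of_forall_odd {σ : Perm (Fin n)} (h : ∀ i ∈ σ.cycleType, Odd i) :
    sign σ = 1 := by
  rw [sign_of_cycleType']
  refine Multiset.prod_eq_one fun x hx => ?_
  obtain ⟨i, hi, rfl⟩ := Multiset.mem_map.1 hx
  rw [(h i hi).neg_one_pow, neg_neg]

/-- Euler's theorem on odd and distinct parts. -/
theorem card_forall_odd_eq_card_isStrict (n : ℕ) :
    Nat.card {p : n.Partition // ∀ i ∈ p.parts, Odd i} =
      Nat.card {p : n.Partition // p.IsStrict} := by
  classical
  have h := Nat.Partition.card_odds_eq_card_distincts n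
  rw [Nat.card_eq_fintype_card, Nat.card_eq_fintype_card, Fintype.card_subtype,
    Fintype.card_subtype]
  convert h using 2
  · ext p
    simp [Nat.Partition.odds, Nat.Partition.restricted]
  · ext p
    exact Finset.mem_filter.trans (by simp [Nat.Partition.distincts, Nat.Partition.IsStrict])

theorem card_subtype_eq_add {α : Type*} [Finite α] {p q r : α → Prop} (h : ∀ x, p x ↔ q x ∨ r x)
    (hd : ∀ x, q x → ¬ r x) :
    Nat.card {x // p x} = Nat.card {x // q x} + Nat.card {x // r x} := by
  classical
  cases nonempty_fintype α
  simp only [Nat.card_eq_fintype_card, Fintype.card_subtype]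
  rw [← Finset.card_union_of_disjoint]
  · congr 1
    ext x
    simp [h]
  · rw [Finset.disjoint_left]
    intro x hx hx'
    exact hd x (Finset.mem_filter.1 hx).2 (Finset.mem_filter.1 hx').2

theorem card_isStrict_eq_add (n : ℕ) : Nat.card {p : n.Partition // p.IsStrict} =
    Nat.card {p : n.Partition // p.IsStrict ∧ p.IsEven} +
      Nat.card {p : n.Partition // p.IsStrict ∧ p.IsOdd} := by
  refine card_subtype_eq_add (fun p => ?_) fun p h1 h2 => ?_
  · obtain ⟨σ, rfl⟩ := permPartition_surjective p
    refine ⟨fun h => ?_, fun h => h.elim And.left And.left⟩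
    rcases Int.units_eq_one_or (sign σ) with hσ | hσ
    · exact Or.inl ⟨h, σ, rfl, hσ⟩
    · exact Or.inr ⟨h, σ, rfl, hσ⟩
  · obtain ⟨-, σ, hσ, hs⟩ := h1
    obtain ⟨-, τ, hτ, ht⟩ := h2
    have hc : IsConj σ τ := permPartition_eq_iff.1 (Nat.Partition.ext (hσ.trans hτ.symm))
    obtain ⟨c, rfl⟩ := isConj_iff.1 hc
    simp [hs] at ht

end Partitions

/-! ### The lift system of the twisted group algebra -/

namespace TwistedSymmetricGroup

open Equiv Equiv.Perm

variable (k : Type u) [Field k] [CharZero k] (n : ℕ)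

/-- The twisted group algebra as a lift system. -/
noncomputable def liftSystem : LiftSystem k (Alg k n) (Perm (Fin n)) where
  IsLift := IsLift k
  one := isLift_one
  mul := IsLift.mul
  isUnit := IsLift.isUnit
  eq_or_eq_neg hx hy := hx.eq_or_eq_neg hy
  basis := basis k n
  isLift_basis σ := by
    rw [basis_apply]
    exact isLift_lift k σ

instance isSemisimpleRing : IsSemisimpleRing (Alg k n) := (liftSystem k n).isSemisimpleRing

theorem anticommutes : (liftSystem k n).Anticommutes := by
  by_cases hn : 4 ≤ n
  · let f : Fin 4 → Fin n := Fin.castLE hn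
    have hnodup : [f 0, f 1, f 2, f 3].Nodup := by simp [f]
    refine LiftSystem.anticommutes_of_exists (f 0) (f 1) (f 2) (f 3) hnodup ?_
    -- The indices 0 and 2 are the generators $s_1$ and $s_3$, whose relation decides the sign for
    -- all disjoint transpositions.
    refine LiftSystem.eps_eq_of_mul_eq (disjoint_swap_swap hnodup).commute
      (isLift_s (k := k) ⟨0, by omega⟩) (isLift_s (k := k) ⟨2, by omega⟩) ?_
    rw [Units.neg_smul, one_smul]
    exact s_anticomm k n _ _ (Or.inl le_rfl)
  -- With fewer than four points there are no such quadruples.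
  · intro a b c d h
    have := h.length_le_card
    simp at this
    omega

theorem parityConj_basis (σ : Perm (Fin n)) :
    parityConj (grading k n) (basis k n σ) = sign σ • basis k n σ := by
  obtain ⟨d, hd, hs⟩ := ((liftSystem k n).isLift_basis σ : IsLift k _ σ).mem_grading
  rw [hs]
  rcases Nat.even_or_odd d with h | h
  · rw [(ZMod.natCast_eq_zero_iff_even).2 h] at hd
    rw [h.neg_one_pow, one_smul]
    exact parityConj_of_mem_zero hd
  · rw [(ZMod.natCast_eq_one_iff_odd).2 h] at hd
    rw [h.neg_one_pow, Units.neg_smul, one_smul]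
    exact parityConj_of_mem_one hd

theorem repr_parityConj (a : Alg k n) (σ : Perm (Fin n)) :
    (basis k n).repr (parityConj (grading k n) a) σ = sign σ • (basis k n).repr a σ := by
  conv_lhs => rw [← (basis k n).sum_repr a]
  simp only [map_sum, map_smul, parityConj_basis, Units.smul_def, map_zsmul,
    Module.Basis.repr_self, Finsupp.finsetSum_apply, Finsupp.smul_apply]
  rw [Finset.sum_eq_single σ]
  · rw [Finsupp.single_eq_same, smul_comm, smul_eq_mul, mul_one]
  · intro τ _ h
    rw [Finsupp.single_eq_of_ne h.symm, smul_zero, smul_zero]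
  · exact fun h => absurd (Finset.mem_univ _) h

/-- Parity acts on the basis element of `σ` by `sign σ`, so degree becomes the support condition
used in `finrank_central_eq_card`. -/
theorem mem_grading_zero_iff (a : Alg k n) :
    a ∈ grading k n 0 ↔ ∀ σ, ¬ sign σ = 1 → (basis k n).repr a σ = 0 := by
  rw [mem_zero_iff_parityConj, ← (basis k n).repr.injective.eq_iff, Finsupp.ext_iff]
  refine forall_congr' fun σ => ?_
  rw [repr_parityConj]
  rcases Int.units_eq_one_or (sign σ) with h | h
  · simp [h]
  · rw [h, Units.neg_smul, one_smul, neg_eq_self]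
    exact ⟨fun h _ => h, fun h => h (by decide)⟩

theorem mem_grading_one_iff (a : Alg k n) :
    a ∈ grading k n 1 ↔ ∀ σ, ¬ sign σ = -1 → (basis k n).repr a σ = 0 := by
  rw [mem_one_iff_parityConj, ← (basis k n).repr.injective.eq_iff, Finsupp.ext_iff]
  refine forall_congr' fun σ => ?_
  rw [repr_parityConj, map_neg, Finsupp.neg_apply]
  rcases Int.units_eq_one_or (sign σ) with h | h
  · rw [h, one_smul, self_eq_neg]
    exact ⟨fun h _ => h, fun h => h (by decide)⟩
  · simp [h]

/-- The dimension of the even centre is the number of strict partitions. -/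
theorem finrank_gradedCenter_zero : Module.finrank k (gradedCenter (grading k n) 0) =
    Nat.card {p : n.Partition // p.IsStrict} := by
  rw [LiftSystem.finrank_central_eq_card (S := liftSystem k n) (fun σ => sign σ = 1)
    (fun σ τ h hs => ?_) _ fun a => ?_, ← card_forall_odd_eq_card_isStrict]
  · refine card_conjClasses_eq_card_partition (fun σ => sign σ = 1 ∧ (liftSystem k n).IsSplit σ) _
      fun σ => ?_
    rw [forall_odd_parts_iff]
    constructor
    · rintro ⟨τ, hτ, hs, h⟩
      rw [← (isConj_iff_cycleType_eq.1 hτ)]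
      exact (LiftSystem.isSplit_iff_of_sign_eq_one (anticommutes k n) hs).1 h
    -- Cycles of odd length are even permutations, so the sign condition is automatic.
    · exact fun h => ⟨σ, IsConj.refl σ, sign_eq_one_of_forall_odd h,
        LiftSystem.isSplit_of_forall_odd h⟩
  · obtain ⟨c, rfl⟩ := isConj_iff.1 h
    simp [hs]
  · rw [mem_gradedCenter, mem_grading_zero_iff]
    rfl

/-- The dimension of the odd centre is the number of odd strict partitions. -/
theorem finrank_gradedCenter_one : Module.finrank k (gradedCenter (grading k n) 1) =
    Nat.card {p : n.Partition // p.IsStrict ∧ p.IsOdd} := by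
  rw [LiftSystem.finrank_central_eq_card (S := liftSystem k n) (fun σ => sign σ = -1)
    (fun σ τ h hs => ?_) _ fun a => ?_]
  · refine card_conjClasses_eq_card_partition (fun σ => sign σ = -1 ∧ (liftSystem k n).IsSplit σ) _
      fun σ => ?_
    constructor
    · rintro ⟨τ, hτ, hs, h⟩
      have hp := permPartition_eq_iff.2 hτ
      rw [← hp]
      exact ⟨(LiftSystem.isSplit_iff_of_sign_eq_neg_one (anticommutes k n) hs).1 h, τ, rfl, hs⟩
    · rintro ⟨hp, τ, hτ, hs⟩
      refine ⟨τ, permPartition_eq_iff.1 (Nat.Partition.ext hτ), hs,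
        (LiftSystem.isSplit_iff_of_sign_eq_neg_one (anticommutes k n) hs).2 ?_⟩
      rw [hτ]
      exact hp
  · obtain ⟨c, rfl⟩ := isConj_iff.1 h
    simp [hs]
  · rw [mem_gradedCenter, mem_grading_one_iff]
    rfl

end TwistedSymmetricGroup

theorem mainTheorem10 (k : Type u) [Field k] [IsAlgClosed k] [CharZero k] (n : ℕ) :
    Finite (IrreducibleClass (TwistedSymmetricGroup.grading k n)) ∧
    Nat.card (IrreducibleClass (TwistedSymmetricGroup.grading k n)) =
      Nat.card {p : n.Partition // p.IsStrict} ∧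
    Nat.card {c : IrreducibleClass (TwistedSymmetricGroup.grading k n) //
        c.IsAbsolutelyIrreducible} =
      Nat.card {p : n.Partition // p.IsStrict ∧ p.IsEven} ∧
    Nat.card {c : IrreducibleClass (TwistedSymmetricGroup.grading k n) //
        c.IsSelfAssociate} =
      Nat.card {p : n.Partition // p.IsStrict ∧ p.IsOdd} := by
  have hfin : Finite (IrreducibleClass (TwistedSymmetricGroup.grading k n)) :=
    IrreducibleClass.finite
  have htotal := (IrreducibleClass.card_eq_finrank_gradedCenter_zero
    (𝒜 := TwistedSymmetricGroup.grading k n)).trans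
      (TwistedSymmetricGroup.finrank_gradedCenter_zero k n)
  have hself := (IrreducibleClass.card_isSelfAssociate_eq_finrank_gradedCenter_one
    (𝒜 := TwistedSymmetricGroup.grading k n)).trans
      (TwistedSymmetricGroup.finrank_gradedCenter_one k n)
  refine ⟨hfin, htotal, ?_, hself⟩
  have hsplit := card_subtype_eq_add
    (p := fun _ : IrreducibleClass (TwistedSymmetricGroup.grading k n) => True)
    (q := fun c => c.IsAbsolutelyIrreducible) (r := fun c => c.IsSelfAssociate)
    (fun c => ⟨fun _ => (Classical.em c.IsSelfAssociate).symm, fun _ => trivial⟩) fun c h => h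
  -- Both totals split in two and their self-associate and odd summands agree, so the remaining
  -- summands agree as well.
  rw [Nat.card_congr (Equiv.subtypeUnivEquiv fun _ => trivial), htotal, card_isStrict_eq_add,
    hself] at hsplit
  exact (Nat.add_right_cancel hsplit).symm
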